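/- \textbf{Setting.} A finite multi-sorted signature $\Sigma=(\sigma,\tau,\mathrm{ar})$ has finite sets $\sigma$ of relation symbols and $\tau$ of sorts, and each $\phi\in\sigma$ has as arity a finite $\tau$-sorted set $\mathrm{ar}(\phi)$; maps between sorted sets preserve sorts. A valued $\Sigma$-structure $\mathbf A$ has a finite $\tau$-sorted domain $A$ and a function $\phi^{\mathbf A}:A^{\mathrm{ar}(\phi)}\to\mathbb Q\cup\{-\infty\}$ for each $\phi\in\sigma$; $\mathrm{feas}(\mathbf A)$ is the relational structure whose relations are the sets of tuples of finite payoff. A payoff formula over a finite $\tau$-sorted set $X$ is a finite formal sum $\Phi=\sum_{i\in I}w_i\phi_i(\mathbf x_i)$ with $w_i\in\mathbb Q_{\ge 0}$, $\phi_i\in\sigma$, $\mathbf x_i\in X^{\mathrm{ar}(\phi_i)}$; its weight is $w(\Phi)=\sum_i w_i$, it is normalized if $w(\Phi)=1$, and for $h:X\to A$ its value is $\Phi^{\mathbf A}(h)=\sum_i w_i\phi_i^{\mathbf A}(h\circ\mathbf x_i)$, where $0\cdot(-\infty)=-\infty$. For valued $\Sigma$-structures $\mathbf A,\mathbf B$ and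 numbers $c,s$, an instance of $\mathrm{PCSP}(\mathbf A,\mathbf B,c,s)$ is a finite $\tau$-sorted set $X$ with a payoff formula $\Phi$ over $X$; it is a yes-instance if $\Phi^{\mathbf A}(h)\ge c\,w(\Phi)$ for some $h:X\to A$, and a no-instance if $\Phi^{\mathbf B}(h)<s\,w(\Phi)$ for all $h:X\to B$. The quadruple $(\mathbf A,\mathbf B,c,s)$ with $c,s\in\mathbb Q$ is a valued promise template if, for every payoff $\Sigma$-formula $\Phi$, $\exists h\ \Phi^{\mathbf A}(h)\ge c\,w(\Phi)$ implies $\exists h\ \Phi^{\mathbf B}(h)\ge s\,w(\Phi)$. For disjoint finite sets $D,E$, $\mathrm{GLC}_{D,E}(c',s')$ is $\mathrm{PCSP}(\mathbf L,\mathbf L,c',s')$, where $\mathbf L$ has two sorts with $D$ and $E$ as domains and one binary symbol for each $\pi:D\to E$, with $\pi^{\mathbf L}(d,e)=1$ if $\pi(d)=e$ and $\pi^{\mathbf L}(d,e)=0$ otherwise ($d\in D$, $e\in E$). For promise problems, $P\le Q$ means that there is a polynomial-time computable map from instances of $P$ to instances of $Q$ which sends yes-instances to yes-instances and no-instances to no-instances.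 For a finite set $N$, $A^N$ is the sorted set whose $t$-th sort is the set of all functions $N\to A_t$, $\mathrm{proj}^N_n:A^N\to A$ is $\mathbf a\mapsto\mathbf a(n)$, $\mathcal M^{(N)}$ is the set of all sorted functions $A^N\to B$ that are polymorphisms of $(\mathrm{feas}(\mathbf A),\mathrm{feas}(\mathbf B))$, and $\Delta N$ is the set of probability distributions on $N$ with rational probabilities. A pair of sorted functions $f_D:A^D\to A'$, $f_E:A^E\to A'$ is identified with an assignment $A^D\cup A^E\to A'$, where the union is disjoint. \textbf{Proposition (Reductions from GLC).} Let $(\mathbf A,\mathbf B,c,s)$ be a valued promise template, $\mathcal M^{(N)}$ as above, $D$ and $E$ finite disjoint sets, and $\varepsilon\in\mathbb R$. Suppose that there exist mappings $\Lambda_D:\mathcal M^{(D)}\to\Delta D$ and $\Lambda_E:\mathcal M^{(E)}\to\Delta E$ and, for every $\pi:D\to E$, a normalized payoff formula $\Phi_\pi$ over the set of variables $A^D\cup A^E$ and a nondecreasing function $\gamma_\pi:\mathbb R\to\mathbb R$ of the form $\gamma_\pi(x)=\alpha_\pi x+\beta_\pi$ with $\gamma_\pi(s)\ge\varepsilon$,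 such that for every $\pi:D\to E$ 1. $\Phi_\pi^{\mathbf A}(\mathrm{proj}^D_d,\mathrm{proj}^E_{\pi(d)})\ge c$ for every $d\in D$, and 2. $\gamma_\pi\bigl(\Phi_\pi^{\mathbf B}(f_D,f_E)\bigr)\le\Pr_{d\sim\Lambda_D(f_D),\,e\sim\Lambda_E(f_E)}[\pi(d)=e]$ (with $d,e$ independent) for all $f_D\in\mathcal M^{(D)}$, $f_E\in\mathcal M^{(E)}$, where $\gamma_\pi(-\infty)=-\infty$. Then $\mathrm{GLC}_{D,E}(1,\varepsilon)\le\mathrm{PCSP}(\mathbf A,\mathbf B,c,s)$. -/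

import Mathlib

namespace ValuedPCSP

/-! ## Multi-sorted sets, signatures and structures

A `τ`-sorted set is represented by the family of its sorts, `X : τ → Type`. -/

/-- A finite multi-sorted signature: finitely many relation symbols, finitely many sort symbols,
and for every relation symbol its arity, a finite sorted set. -/
structure Signature where
  /-- relation symbols -/
  Rel : Type
  /-- sort symbols -/
  Srt : Type
  /-- the underlying set of the arity of a relation symbol -/
  Ar : Rel → Type
  /-- the sorts of the elements of an arity -/
  arSort : ∀ φ : Rel, Ar φ → Srt
  [finRel : Finite Rel]
  [finSrt : Finite Srt]
  [finAr : ∀ φ, Finite (Ar φ)]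

attribute [instance] Signature.finRel Signature.finSrt Signature.finAr

/-- Sorted functions `X → Y` between sorted sets (assignments of values in `Y` to the
variables in `X`). -/
abbrev SortedMap {τ : Type} (X Y : τ → Type) : Type := ∀ t, X t → Y t

/-- Sorted tuples of elements of `X` indexed by the arity of `φ`. -/
abbrev Tuple (S : Signature) (X : S.Srt → Type) (φ : S.Rel) : Type :=
  ∀ z : S.Ar φ, X (S.arSort φ z)

/-- The componentwise application of a sorted function to a tuple. -/
def Tuple.comp {S : Signature} {X Y : S.Srt → Type} (h : SortedMap X Y) {φ : S.Rel}
    (x : Tuple S X φ) : Tuple S Y φ :=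
  fun z => h _ (x z)

/-- A finite (crisp) relational structure. -/
structure RelStructure (S : Signature) where
  /-- the domain -/
  Dom : S.Srt → Type
  [finDom : ∀ t, Finite (Dom t)]
  /-- the interpretations of the relation symbols -/
  rel : ∀ φ : S.Rel, Set (Tuple S Dom φ)

/-- A finite valued structure; payoffs are in `ℚ ∪ {-∞}`. -/
structure ValuedStructure (S : Signature) where
  /-- the domain -/
  Dom : S.Srt → Type
  [finDom : ∀ t, Finite (Dom t)]
  /-- the interpretations of the relation symbols -/
  payoff : ∀ φ : S.Rel, Tuple S Dom φ → WithBot ℚ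

attribute [instance] RelStructure.finDom ValuedStructure.finDom

/-- The feasibility structure: the tuples of finite payoff. -/
def ValuedStructure.feas {S : Signature} (A : ValuedStructure S) : RelStructure S where
  Dom := A.Dom
  rel φ := {a | A.payoff φ a ≠ ⊥}

/-! ## Polymorphisms -/

/-- The sorted set `A^N`: the functions from `N` into one of the sorts of `A`. -/
abbrev Pow {τ : Type} (A : τ → Type) (N : Type) : τ → Type := fun t => N → A t

/-- The `N`-ary projection to the coordinate `n`. -/
def proj {τ : Type} (A : τ → Type) {N : Type} (n : N) : SortedMap (Pow A N) A :=
  fun _ a => a n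

/-- `f : A^N → B` is a polymorphism: for every symbol `φ` and every matrix `M`, given by its rows,
all of whose columns are in the relation of `A`, the tuple `f rows(M)` is in the relation
of `B`. -/
def IsPolymorphism {S : Signature} (A B : RelStructure S) {N : Type}
    (f : SortedMap (Pow A.Dom N) B.Dom) : Prop :=
  ∀ (φ : S.Rel) (M : Tuple S (Pow A.Dom N) φ),
    (∀ n : N, M.comp (proj A.Dom n) ∈ A.rel φ) → M.comp f ∈ B.rel φ

/-- The `N`-ary polymorphisms of the pair of feasibility structures. -/
def PolFeas {S : Signature} (A B : ValuedStructure S) (N : Type) : Type :=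
  {f : SortedMap (Pow A.Dom N) B.Dom // IsPolymorphism A.feas B.feas f}

/-! ## Payoff formulas -/

/-- A weighted constraint `w φ(x)` over the sorted set of variables `X`. -/
structure Constraint (S : Signature) (X : S.Srt → Type) where
  /-- the weight, a nonnegative rational -/
  weight : ℚ≥0
  /-- the relation symbol -/
  sym : S.Rel
  /-- the tuple of variables -/
  args : Tuple S X sym

/-- A payoff formula: a finite formal sum of weighted constraints. -/
abbrev PayoffFormula (S : Signature) (X : S.Srt → Type) : Type := List (Constraint S X)

/-- The weight `w(Φ)` of a payoff formula. -/
def totalWeight {S : Signature} {X : S.Srt → Type} (Φ : PayoffFormula S X) : ℚ≥0 :=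
  (Φ.map Constraint.weight).sum

/-- The interpretation of a payoff formula, `Φ^A(h) = ∑ w φ^A(h x)`. A summand with an infinite
payoff is `-∞`, also when its weight is zero. -/
def eval {S : Signature} {X : S.Srt → Type} (Φ : PayoffFormula S X) (A : ValuedStructure S)
    (h : SortedMap X A.Dom) : WithBot ℚ :=
  (Φ.map fun C =>
    WithBot.map (fun q : ℚ => (C.weight : ℚ) * q) (A.payoff C.sym (C.args.comp h))).sum

/-- The inclusion of `ℚ ∪ {-∞}` into `ℝ ∪ {-∞}`. -/
noncomputable def toReal (v : WithBot ℚ) : WithBot ℝ := WithBot.map (fun q : ℚ => (q : ℝ)) v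

/-- `Φ^A(h) ≥ c w(Φ)`. -/
def AtLeast {S : Signature} {X : S.Srt → Type} (Φ : PayoffFormula S X) (A : ValuedStructure S)
    (h : SortedMap X A.Dom) (c : ℝ) : Prop :=
  ((c * (totalWeight Φ : ℝ) : ℝ) : WithBot ℝ) ≤ toReal (eval Φ A h)

/-- `Φ^A(h) < s w(Φ)`. -/
def Below {S : Signature} {X : S.Srt → Type} (Φ : PayoffFormula S X) (A : ValuedStructure S)
    (h : SortedMap X A.Dom) (s : ℝ) : Prop :=
  toReal (eval Φ A h) < ((s * (totalWeight Φ : ℝ) : ℝ) : WithBot ℝ)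

/-- `(A, B, c, s)` is a valued promise template. -/
def IsTemplate {S : Signature} (A B : ValuedStructure S) (c s : ℝ) : Prop :=
  ∀ (X : S.Srt → Type) [∀ t, Finite (X t)] (Φ : PayoffFormula S X),
    (∃ h, AtLeast Φ A h c) → ∃ h, AtLeast Φ B h s

/-! ## Promise problems and polynomial-time reductions -/

/-- A promise problem: instances written injectively as words over a finite alphabet, together
with the yes-instances and the no-instances. -/
structure PromiseProblem where
  /-- instances -/
  Inst : Type
  /-- the alphabet -/
  Letter : Type
  finLetter : Finite Letter
  /-- the word that represents an instance -/
  encode : Inst → List Letter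
  encode_injective : Function.Injective encode
  /-- yes-instances -/
  yes : Set Inst
  /-- no-instances -/
  no : Set Inst

/-- Polynomial-time many-one reducibility of promise problems: a function computed by a Turing
machine in time polynomial in the length of the encoded input that sends yes-instances to
yes-instances and no-instances to no-instances. -/
def PolyTimeReducible (P Q : PromiseProblem) : Prop :=
  ∃ f : P.Inst → Q.Inst,
    Nonempty (Turing.TM2ComputableInPolyTime P.encode Q.encode f) ∧
      (∀ I ∈ P.yes, f I ∈ Q.yes) ∧ ∀ I ∈ P.no, f I ∈ Q.no

/-! ## The promise constraint satisfaction problem -/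

/-- An instance over the signature `S`: a finite sorted set of variables, given by the number of
variables of each sort, and a payoff formula over it. -/
structure Instance (S : Signature) where
  /-- the number of variables of each sort -/
  numVars : S.Srt → ℕ
  /-- the payoff formula -/
  formula : PayoffFormula S fun t => Fin (numVars t)

/-- The alphabet in which instances over a fixed signature are written. -/
inductive Letter (S : Signature) : Type
  | srt (t : S.Srt)
  | sym (φ : S.Rel)
  | bit (b : Bool)
  | tick
  | sep

/-- A fixed enumeration, without repetition, of a finite type. -/
noncomputable def enum (α : Type) [Finite α] : List α :=
  (@Finset.univ α (Fintype.ofFinite α)).toList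

theorem mem_enum {α : Type} [Finite α] (a : α) : a ∈ enum α := by
  simp [enum]

theorem nodup_enum (α : Type) [Finite α] : (enum α).Nodup := by
  simp [enum, Finset.nodup_toList]

/-- Natural numbers in binary. -/
def encodeNum {S : Signature} (n : ℕ) : List (Letter S) :=
  (Computability.encodeNat n).map Letter.bit

/-- A constraint is written as its symbol, the numerator and the denominator of its weight in
binary, and the positions of its variables in the lists of variables of their sorts. A position is
written in unary; as the variables are listed in the instance, this changes the length of an
instance at most polynomially in comparison to binary positions. -/
noncomputable def encodeConstraint {S : Signature} {n : S.Srt → ℕ}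
    (C : Constraint S fun t => Fin (n t)) : List (Letter S) :=
  Letter.sym C.sym ::
    (encodeNum C.weight.num ++ Letter.sep :: (encodeNum C.weight.den ++ Letter.sep ::
      (enum (S.Ar C.sym)).flatMap fun z =>
        List.replicate (C.args z : ℕ) Letter.tick ++ [Letter.sep]))

/-- An instance is written as the list of the sorts of its variables, followed by its
constraints. -/
noncomputable def encodeInstance {S : Signature} (I : Instance S) : List (Letter S) :=
  ((enum S.Srt).flatMap fun t => List.replicate (I.numVars t) (Letter.srt t)) ++
    I.formula.flatMap encodeConstraint

theorem finite_letter (S : Signature) : Finite (Letter S) := by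
  let g : S.Srt ⊕ S.Rel ⊕ Bool ⊕ Bool → Letter S := fun x =>
    match x with
    | .inl t => .srt t
    | .inr (.inl φ) => .sym φ
    | .inr (.inr (.inl b)) => .bit b
    | .inr (.inr (.inr true)) => .tick
    | .inr (.inr (.inr false)) => .sep
  refine Finite.of_surjective g ?_
  rintro (t | φ | b | _ | _)
  · exact ⟨.inl t, rfl⟩
  · exact ⟨.inr (.inl φ), rfl⟩
  · exact ⟨.inr (.inr (.inl b)), rfl⟩
  · exact ⟨.inr (.inr (.inr true)), rfl⟩
  · exact ⟨.inr (.inr (.inr false)), rfl⟩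

theorem encodeNum_append_inj {S : Signature} {m n : ℕ} {l l' : List (Letter S)}
    (h : encodeNum m ++ Letter.sep :: l = encodeNum n ++ Letter.sep :: l') : m = n ∧ l = l' := by
  have key : ∀ (a b : List Bool), a.map Letter.bit ++ Letter.sep :: l =
      b.map (Letter.bit (S := S)) ++ Letter.sep :: l' → a = b ∧ l = l' := by
    intro a
    induction a with
    | nil => intro b hb; cases b <;> simp_all
    | cons x a ih =>
      intro b hb
      cases b with
      | nil => simp at hb
      | cons y b =>
        simp only [List.map_cons, List.cons_append, List.cons.injEq, Letter.bit.injEq] at hb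
        obtain ⟨h1, h2⟩ := ih b hb.2
        exact ⟨by rw [hb.1, h1], h2⟩
  obtain ⟨h1, h2⟩ := key _ _ h
  refine ⟨?_, h2⟩
  rw [← Computability.decode_encodeNat m, h1, Computability.decode_encodeNat]

theorem ticks_append_inj {S : Signature} {m n : ℕ} {l l' : List (Letter S)}
    (h : List.replicate m Letter.tick ++ Letter.sep :: l =
      List.replicate n Letter.tick ++ Letter.sep :: l') : m = n ∧ l = l' := by
  induction m generalizing n with
  | zero => cases n <;> simp_all [List.replicate_succ]
  | succ m ih =>
    cases n with
    | zero => simp [List.replicate_succ] at h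
    | succ n =>
      simp only [List.replicate_succ, List.cons_append, List.cons.injEq, true_and] at h
      obtain ⟨h1, h2⟩ := ih h
      exact ⟨by rw [h1], h2⟩

theorem encodeConstraint_append_inj {S : Signature} {n : S.Srt → ℕ}
    {C C' : Constraint S fun t => Fin (n t)} {l l' : List (Letter S)}
    (h : encodeConstraint C ++ l = encodeConstraint C' ++ l') : C = C' ∧ l = l' := by
  obtain ⟨w, φ, x⟩ := C
  obtain ⟨w', φ', x'⟩ := C'
  simp only [encodeConstraint, List.cons_append, List.append_assoc, List.cons.injEq,
    Letter.sym.injEq] at h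
  obtain ⟨rfl, h⟩ := h
  obtain ⟨h1, h⟩ := encodeNum_append_inj h
  obtain ⟨h2, h⟩ := encodeNum_append_inj h
  have hw : w = w' := by
    rw [← NNRat.num_div_den w, ← NNRat.num_div_den w', h1, h2]
  have key : ∀ L : List (S.Ar φ),
      (L.flatMap fun z => List.replicate (x z : ℕ) Letter.tick ++ [Letter.sep]) ++ l =
      (L.flatMap fun z => List.replicate (x' z : ℕ) Letter.tick ++ [Letter.sep]) ++ l' →
      (∀ z ∈ L, x z = x' z) ∧ l = l' := by
    intro L
    induction L with
    | nil => intro hL; simpa using hL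
    | cons z L ih =>
      intro hL
      simp only [List.flatMap_cons, List.append_assoc, List.singleton_append] at hL
      obtain ⟨h3, h4⟩ := ticks_append_inj hL
      obtain ⟨h5, h6⟩ := ih h4
      refine ⟨?_, h6⟩
      intro y hy
      rcases List.mem_cons.1 hy with rfl | hy
      · exact Fin.ext h3
      · exact h5 y hy
  obtain ⟨h3, h4⟩ := key _ h
  have hx : x = x' := funext fun z => h3 z (mem_enum z)
  subst hw hx
  exact ⟨rfl, h4⟩

theorem encodeInstance_injective (S : Signature) :
    Function.Injective (encodeInstance (S := S)) := by
  classical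
  have count_cons : ∀ (t : S.Srt) {n : S.Srt → ℕ} (Φ : PayoffFormula S fun t => Fin (n t)),
      (Φ.flatMap encodeConstraint).count (Letter.srt t) = 0 := by
    intro t n Φ
    rw [List.count_eq_zero]
    simp [encodeConstraint, encodeNum, List.mem_replicate]
  have count_vars : ∀ (t : S.Srt) (n : S.Srt → ℕ),
      ((enum S.Srt).flatMap fun t => List.replicate (n t) (Letter.srt (S := S) t)).count
        (Letter.srt t) = n t := by
    intro t n
    have key : ∀ L : List S.Srt, L.Nodup →
        (L.flatMap fun t => List.replicate (n t) (Letter.srt (S := S) t)).count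
          (Letter.srt t) = if t ∈ L then n t else 0 := by
      intro L
      induction L with
      | nil => simp
      | cons a L ih =>
        intro hL
        rw [List.nodup_cons] at hL
        rw [List.flatMap_cons, List.count_append, ih hL.2, List.count_replicate]
        by_cases hta : a = t
        · subst hta; simp [hL.1]
        · simp [hta, Ne.symm hta]
    rw [key _ (nodup_enum _), if_pos (mem_enum t)]
  rintro ⟨n, Φ⟩ ⟨n', Φ'⟩ h
  have hn : n = n' := by
    funext t
    have := congrArg (List.count (Letter.srt t)) h
    simpa only [encodeInstance, List.count_append, count_cons, count_vars, add_zero] using this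
  subst hn
  have h' := List.append_cancel_left h
  simp only at h'
  congr 1
  clear h
  induction Φ generalizing Φ' with
  | nil => cases Φ' <;> simp_all [encodeConstraint]
  | cons C Φ ih =>
    cases Φ' with
    | nil => simp [encodeConstraint] at h'
    | cons C' Φ' =>
      simp only [List.flatMap_cons] at h'
      obtain ⟨rfl, h2⟩ := encodeConstraint_append_inj h'
      rw [ih Φ' h2]

/-- The problem `PCSP(A, B, c, s)`. -/
noncomputable def PCSP {S : Signature} (A B : ValuedStructure S) (c s : ℝ) : PromiseProblem where
  Inst := Instance S
  Letter := Letter S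
  finLetter := finite_letter S
  encode := encodeInstance
  encode_injective := encodeInstance_injective S
  yes := {I | ∃ h, AtLeast I.formula A h c}
  no := {I | ∀ h, Below I.formula B h s}

/-! ## Gap Label Cover -/

/-- The two sorts of the Gap Label Cover problem. -/
inductive Side : Type
  | left
  | right

theorem finite_side : Finite Side :=
  Finite.of_surjective (fun b : Bool => if b then Side.left else Side.right) (by
    rintro (_ | _)
    · exact ⟨true, rfl⟩
    · exact ⟨false, rfl⟩)

/-- The signature of Gap Label Cover: a binary symbol for each function `D → E`, whose first
argument is of the left sort and whose second argument is of the right sort. The two argument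
places are named by their sorts. -/
abbrev glcSignature (D E : Type) [Finite D] [Finite E] : Signature where
  Rel := D → E
  Srt := Side
  Ar _ := Side
  arSort _ z := z
  finSrt := finite_side
  finAr _ := finite_side

/-- The domain of Gap Label Cover: `D` in the left sort, `E` in the right sort. -/
def glcDom (D E : Type) : Side → Type
  | .left => D
  | .right => E

open Classical in
/-- `π(d, e)`: one if `π(d) = e`, zero otherwise. -/
noncomputable def labelPayoff {D E : Type} (π : D → E) (d : D) (e : E) : ℚ :=
  if π d = e then 1 else 0

/-- The valued structure of Gap Label Cover. -/
noncomputable def glcStructure (D E : Type) [hD : Finite D] [hE : Finite E] :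
    ValuedStructure (glcSignature D E) where
  Dom := glcDom D E
  finDom t := match t with
    | .left => hD
    | .right => hE
  payoff π x := ((labelPayoff π (x Side.left) (x Side.right) : ℚ) : WithBot ℚ)

/-- The Gap Label Cover problem `GLC_{D,E}(c, s)`. -/
noncomputable def GLC (D E : Type) [Finite D] [Finite E] (c s : ℝ) : PromiseProblem :=
  PCSP (glcStructure D E) (glcStructure D E) c s

/-! ## Data of the reduction -/

/-- `ΔN`: the probability distributions on the finite set `N`, with rational probabilities. -/
def FinDist (N : Type) [Fintype N] : Type := {μ : N → ℚ≥0 // ∑ n, μ n = 1}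

/-- The expected value of `f` under `μ`. -/
def FinDist.expect {N : Type} [Fintype N] (μ : FinDist N) (f : N → ℚ) : ℚ :=
  ∑ n, (μ.1 n : ℚ) * f n

/-- The sorted set of variables `A^D ∪ A^E` (a disjoint union). -/
abbrev PairVars {τ : Type} (A : τ → Type) (D E : Type) : τ → Type :=
  fun t => Pow A D t ⊕ Pow A E t

/-- The assignment on `A^D ∪ A^E` that corresponds to a pair of functions on `A^D` and `A^E`. -/
def pairMap {τ : Type} {A A' : τ → Type} {D E : Type} (fD : SortedMap (Pow A D) A')
    (fE : SortedMap (Pow A E) A') : SortedMap (PairVars A D E) A' :=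
  fun t => Sum.elim (fD t) (fE t)

end ValuedPCSP

open ValuedPCSP

/-!
# Polynomial-time reductions from Gap Label Cover

An instance of Gap Label Cover is reduced by replacing every left variable by a block of variables
`A^D`, every right variable by a block `A^E`, and every constraint with the label `π` by a copy of
the formula `Φ π` on the two blocks concerned (`blockFormula`). Constraints of weight zero are added
to every block. As a summand of infinite payoff is infinite also when its weight is zero, they
force the function on the block of a feasible assignment to `B` to be a polymorphism
(`isFeasible_polPatterns`), and they do not contribute to payoffs and weights.

Completeness (`exists_atLeast_blockFormula`): if a labelling satisfies all constraints of nonzero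
weight, then the projections to the labels are polymorphisms, and by hypothesis they give every
`Φ π` a payoff of at least `c`. Input constraints of weight zero are dropped, since a perfect
labelling may violate them.

Soundness (`exists_glc_atLeast`): the copy of `Φ π` is scaled by the slope `α π` of the affine map
`γ π`. As `γ π x ≥ α π * (x - s) + ε`, an assignment to `B` whose payoff is at least `s` times the
total weight yields, by summing up over the constraints, random labels of expected payoff at least
`ε` times the total weight. By linearity of expectation some fixed labels do as well
(`exists_labelling`).

The weights of an instance have to be rational, while `α π` and `ε` are real. The conditions on
`α π` are finitely many linear inequalities, one for each pair of polymorphisms, with rational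
coefficients and a common real constant term. If they have a real solution, they have a rational one
(`exists_rat_slope`). A common denominator of the scaled weights then makes all of them integers, so
that scaling amounts to repeating constraints of the input weight (`copies`). Hence the reduction
only copies weights and does no arithmetic with them.

The reduction is computable in quadratic time: programs with a finite control acting on finitely
many stacks are composed from elementary instructions, with explicit bounds on the number of steps,
and are compiled to the multi-stack machines of Mathlib (`StackProgram.nonempty_polyTime`). The
reduction program counts the variables of the input in unary, writes the blocks, and then replaces
the constraints one by one (`exists_runsIn_reductionProg`).
-/

/-! ### Programs on finitely many stacks -/

namespace StackProgram

open Function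

section Programs

variable {K : Type} {Γ : K → Type}

/-- The contents of all stacks; the head of a list is the top of the stack. -/
abbrev Stacks (Γ : K → Type) : Type := ∀ k, List (Γ k)

/-- An elementary instruction with continuations in `R`. -/
inductive Action (Γ : K → Type) (R : Type) : Type
  | idle (r : R)
  | push (k : K) (a : Γ k) (r : R)
  | pop (k : K) (r : Option (Γ k) → R)

/-- Rename the continuations of an instruction. -/
def Action.map {R R' : Type} (f : R → R') : Action Γ R → Action Γ R'
  | .idle r => .idle (f r)
  | .push k a r => .push k a (f r)
  | .pop k r => .pop k fun a => f (r a)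

/-- A program is a finite control whose states carry one instruction each. The continuation `none`
is the exit of the program; it is where a sequential composition attaches the next program. -/
structure Prog (Γ : K → Type) where
  /-- control states -/
  Q : Type
  [fin : Finite Q]
  /-- the initial control state -/
  start : Q
  /-- the instruction of a control state -/
  act : Q → Action Γ (Option Q)

attribute [instance] Prog.fin

variable [DecidableEq K]

/-- Execute one instruction. Popping an empty stack is allowed and reports `none`. -/
def Action.exec {R : Type} : Action Γ R → Stacks Γ → R × Stacks Γ
  | .idle r, s => (r, s)
  | .push k a r, s => (r, update s k (a :: s k))
  | .pop k r, s => (r (s k).head?, update s k (s k).tail)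

theorem Action.exec_map {R R' : Type} (f : R → R') (a : Action Γ R) (s : Stacks Γ) :
    (a.map f).exec s = (f (a.exec s).1, (a.exec s).2) := by
  cases a <;> rfl

/-- `Steps P q s n s'`: started in the control state `q` with stacks `s`, the program `P` exits
after exactly `n` instructions with stacks `s'`. -/
inductive Steps (P : Prog Γ) : P.Q → Stacks Γ → ℕ → Stacks Γ → Prop
  | exit {q : P.Q} {s s' : Stacks Γ} (h : (P.act q).exec s = (none, s')) : Steps P q s 1 s'
  | step {q q' : P.Q} {s s' s'' : Stacks Γ} {n : ℕ} (h : (P.act q).exec s = (some q', s'))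
      (h' : Steps P q' s' n s'') : Steps P q s (n + 1) s''

/-- `RunsIn P s s' b`: the program `P` transforms the stacks `s` into `s'` in at most `b` steps. -/
def RunsIn (P : Prog Γ) (s s' : Stacks Γ) (b : ℕ) : Prop :=
  ∃ n ≤ b, Steps P P.start s n s'

theorem RunsIn.mono {P : Prog Γ} {s s' : Stacks Γ} {b b' : ℕ} (h : RunsIn P s s' b)
    (hb : b ≤ b') : RunsIn P s s' b' := by
  obtain ⟨n, hn, h⟩ := h
  exact ⟨n, hn.trans hb, h⟩

theorem Action.length_exec_le {R : Type} (a : Action Γ R) (s : Stacks Γ) (k : K) :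
    ((a.exec s).2 k).length ≤ (s k).length + 1 := by
  cases a with
  | idle r => simp [Action.exec]
  | push k' a r =>
    by_cases h : k = k'
    · subst h; simp [Action.exec]
    · simp [Action.exec, update_of_ne h]
  | pop k' r =>
    by_cases h : k = k'
    · subst h; simp [Action.exec]; omega
    · simp [Action.exec, update_of_ne h]

theorem Steps.length_le {P : Prog Γ} {q : P.Q} {s s' : Stacks Γ} {n : ℕ} (h : Steps P q s n s')
    (k : K) : (s' k).length ≤ (s k).length + n := by
  induction h with
  | @exit q s _ h => simpa [h] using Action.length_exec_le (P.act q) s k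
  | @step q _ s _ _ _ h _ ih =>
    have := Action.length_exec_le (P.act q) s k
    simp only [h] at this
    omega

/-- A program pushes at most one letter per step, so that the length of its output is bounded by
its running time. -/
theorem RunsIn.length_le {P : Prog Γ} {s s' : Stacks Γ} {b : ℕ} (h : RunsIn P s s' b) (k : K) :
    (s' k).length ≤ (s k).length + b := by
  obtain ⟨n, hn, h⟩ := h
  have := h.length_le k
  omega

/-! ### Program constructors -/

/-- Do nothing. -/
def skip : Prog Γ where
  Q := Unit
  start := ()
  act _ := .idle none

/-- Push the letter `a` onto the stack `k`. -/
def push (k : K) (a : Γ k) : Prog Γ where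
  Q := Unit
  start := ()
  act _ := .push k a none

/-- Run `P`, then `R`. -/
def seq (P R : Prog Γ) : Prog Γ where
  Q := P.Q ⊕ R.Q
  start := .inl P.start
  act
    | .inl q => (P.act q).map fun
      | some q' => some (.inl q')
      | none => some (.inr R.start)
    | .inr q => (R.act q).map (Option.map .inr)

/-- Pop the stack `k` and run the program that `body` assigns to the result; then start again if
`again` says so, and exit otherwise. This is both the case distinction and the loop. -/
def popLoop (k : K) [Finite (Γ k)] (again : Option (Γ k) → Bool) (body : Option (Γ k) → Prog Γ) :
    Prog Γ where
  Q := Option (Σ a, (body a).Q)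
  start := none
  act
    | none => .pop k fun a => some (some ⟨a, (body a).start⟩)
    | some ⟨a, q⟩ => ((body a).act q).map fun
      | some q' => some (some ⟨a, q'⟩)
      | none => if again a then some none else none

/-- Run the programs of a list one after the other. -/
def seqList : List (Prog Γ) → Prog Γ
  | [] => skip
  | P :: l => seq P (seqList l)

theorem runsIn_skip (s : Stacks Γ) : RunsIn skip s s 1 :=
  ⟨1, le_rfl, .exit rfl⟩

theorem runsIn_push (k : K) (a : Γ k) (s : Stacks Γ) :
    RunsIn (push k a) s (update s k (a :: s k)) 1 :=
  ⟨1, le_rfl, .exit rfl⟩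

theorem RunsIn.seq {P R : Prog Γ} {s s' s'' : Stacks Γ} {b b' : ℕ} (h : RunsIn P s s' b)
    (h' : RunsIn R s' s'' b') : RunsIn (seq P R) s s'' (b + b') := by
  obtain ⟨n, hn, h⟩ := h
  obtain ⟨m, hm, h'⟩ := h'
  have right : ∀ {q s m s''}, Steps R q s m s'' →
      Steps (StackProgram.seq P R) (.inr q) s m s'' := by
    intro q s m s'' h
    induction h with
    | exit h => exact .exit (by simp [StackProgram.seq, Action.exec_map, h])
    | step h _ ih => exact .step (by simp [StackProgram.seq, Action.exec_map, h]) ih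
  refine ⟨m + n, by omega, ?_⟩
  have left : ∀ {q s n s'}, Steps P q s n s' → Steps R R.start s' m s'' →
      Steps (StackProgram.seq P R) (.inl q) s (m + n) s'' := by
    intro q s n s' h h'
    induction h with
    | exit h => exact .step (by simp [StackProgram.seq, Action.exec_map, h]) (right h')
    | step h _ ih => exact .step (by simp [StackProgram.seq, Action.exec_map, h]) (ih h')
  exact left h h'

section popLoop

variable {k : K} [Finite (Γ k)] {again : Option (Γ k) → Bool} {body : Option (Γ k) → Prog Γ}

theorem RunsIn.popLoop_exit {s s' : Stacks Γ} {b : ℕ} (ha : again (s k).head? = false)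
    (h : RunsIn (body (s k).head?) (update s k (s k).tail) s' b) :
    RunsIn (popLoop k again body) s s' (b + 1) := by
  obtain ⟨n, hn, h⟩ := h
  have key : ∀ {a q s n s'}, again a = false → Steps (body a) q s n s' →
      Steps (popLoop k again body) (some ⟨a, q⟩) s n s' := by
    intro a q s n s' ha h
    induction h with
    | exit h => exact .exit (by simp [popLoop, Action.exec_map, h, ha])
    | step h _ ih => exact .step (by simp [popLoop, Action.exec_map, h]) ih
  exact ⟨n + 1, by omega, .step (q' := some ⟨_, _⟩) rfl (key ha h)⟩

theorem RunsIn.popLoop_again {s s' s'' : Stacks Γ} {b b' : ℕ} (ha : again (s k).head? = true)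
    (h : RunsIn (body (s k).head?) (update s k (s k).tail) s' b)
    (h' : RunsIn (popLoop k again body) s' s'' b') :
    RunsIn (popLoop k again body) s s'' (b' + b + 1) := by
  obtain ⟨n, hn, h⟩ := h
  obtain ⟨m, hm, h'⟩ := h'
  have key : ∀ {a q s n s'}, again a = true → Steps (body a) q s n s' →
      Steps (popLoop k again body) none s' m s'' →
      Steps (popLoop k again body) (some ⟨a, q⟩) s (m + n) s'' := by
    intro a q s n s' ha h h'
    induction h with
    | exit h => exact .step (by simp [popLoop, Action.exec_map, h, ha]) h'
    | step h _ ih => exact .step (by simp [popLoop, Action.exec_map, h]) (ih h')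
  exact ⟨m + n + 1, by omega, .step (q' := some ⟨_, _⟩) rfl (key ha h h')⟩

end popLoop

/-- Pop letters from the stack `k` and run the program assigned to each of them, until the stack
is empty or a letter without a program has been popped. -/
def readWhile (k : K) [Finite (Γ k)] (P : Γ k → Option (Prog Γ)) : Prog Γ :=
  popLoop k (fun a => (a.bind P).isSome) fun a => (a.bind P).getD skip

section readWhile

variable {k : K} [Finite (Γ k)] {P : Γ k → Option (Prog Γ)} {s s₁ s' s'' : Stacks Γ}
  {a : Γ k} {l : List (Γ k)} {b b' : ℕ}

theorem runsIn_readWhile_nil (hs : s k = []) : RunsIn (readWhile k P) s s 2 := by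
  refine RunsIn.popLoop_exit (b := 1) (by simp [hs]) ?_
  have : update s k (s k).tail = s := by rw [hs, List.tail_nil, ← hs, update_eq_self]
  rw [this, hs]
  exact runsIn_skip s

theorem runsIn_readWhile_stop (hs : s k = a :: l) (hu : update s k l = s₁) (hP : P a = none) :
    RunsIn (readWhile k P) s s₁ 2 := by
  refine RunsIn.popLoop_exit (b := 1) (by simp [hs, hP]) ?_
  simp only [hs, List.head?_cons, List.tail_cons, hu, Option.bind_some, hP, Option.getD_none]
  exact runsIn_skip s₁

theorem RunsIn.readWhile_cons {p : Prog Γ} (hs : s k = a :: l) (hu : update s k l = s₁)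
    (h : RunsIn p s₁ s' b) (h' : RunsIn (readWhile k P) s' s'' b') (hP : P a = some p) :
    RunsIn (readWhile k P) s s'' (b' + b + 1) := by
  refine RunsIn.popLoop_again (by simp [hs, hP]) ?_ h'
  simpa only [hs, List.head?_cons, List.tail_cons, hu, Option.bind_some, hP, Option.getD_some]
    using h

end readWhile

end Programs

/-! ### Compilation to Turing machines -/

section Compile

open Turing

variable {K : Type} [DecidableEq K] {Γ : K → Type}

/-- The letter of the stack `k` that is remembered in the internal state. -/
def lastPopped (k : K) : Option (Σ k, Γ k) → Option (Γ k)
  | none => none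
  | some ⟨k', a⟩ => if h : k' = k then some (h ▸ a) else none

theorem lastPopped_map_mk (k : K) (a : Option (Γ k)) : lastPopped k (a.map (Sigma.mk k)) = a := by
  cases a <;> simp [lastPopped]

/-- The statement of the machine for an instruction; the popped letter is kept in the internal
state, where the subsequent jump reads it. -/
def Action.stmt {R : Type} : Action Γ R → TM2.Stmt Γ R (Option (Σ k, Γ k))
  | .idle r => .goto fun _ => r
  | .push k a r => .push k (fun _ => a) (.goto fun _ => r)
  | .pop k r => .pop k (fun _ a => a.map (Sigma.mk k)) (.goto fun v => r (lastPopped k v))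

theorem Action.stepAux_stmt {R : Type} (a : Action Γ R) (v : Option (Σ k, Γ k)) (s : Stacks Γ) :
    ∃ v', TM2.stepAux a.stmt v s = ⟨some (a.exec s).1, v', (a.exec s).2⟩ := by
  cases a <;> simp [Action.stmt, Action.exec, lastPopped_map_mk]

/-- The machine of a program. Its additional label `none` resets the internal state and halts. -/
noncomputable def Prog.toTM2 [Fintype K] [∀ k, Finite (Γ k)] (P : Prog Γ) (k₀ k₁ : K) : FinTM2 where
  K := K
  k₀ := k₀
  k₁ := k₁
  Γ := Γ
  Λ := Option P.Q
  main := some P.start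
  ΛFin := Fintype.ofFinite _
  σ := Option (Σ k, Γ k)
  initialState := none
  σFin := Fintype.ofFinite _
  Γk₀Fin := Fintype.ofFinite _
  m
    | none => .load (fun _ => none) .halt
    | some q => (P.act q).stmt

theorem Steps.iterate_toTM2 [Fintype K] [∀ k, Finite (Γ k)] {P : Prog Γ} (k₀ k₁ : K) {q : P.Q}
    {s s' : Stacks Γ} {n : ℕ} (h : Steps P q s n s') (v : Option (Σ k, Γ k)) :
    (flip bind (P.toTM2 k₀ k₁).step)^[n + 1] (some ⟨some (some q), v, s⟩) =
      some ⟨none, none, s'⟩ := by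
  induction h generalizing v with
  | @exit q s s' h =>
    obtain ⟨v', hv'⟩ := (P.act q).stepAux_stmt v s
    rw [h] at hv'
    have h1 : (P.toTM2 k₀ k₁).step ⟨some (some q), v, s⟩ = some ⟨some none, v', s'⟩ :=
      congrArg some hv'
    have h2 : (P.toTM2 k₀ k₁).step ⟨some none, v', s'⟩ = some ⟨none, none, s'⟩ := rfl
    rw [iterate_succ_apply, iterate_one]
    exact (congrArg (flip bind (P.toTM2 k₀ k₁).step) h1).trans h2
  | @step q q' s s' s'' n h _ ih =>
    obtain ⟨v', hv'⟩ := (P.act q).stepAux_stmt v s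
    rw [h] at hv'
    have h1 : (P.toTM2 k₀ k₁).step ⟨some (some q), v, s⟩ = some ⟨some (some q'), v', s'⟩ :=
      congrArg some hv'
    rw [iterate_succ_apply]
    exact (congrArg (flip bind (P.toTM2 k₀ k₁).step)^[n + 1] h1).trans (ih v')

theorem dite_eq_update (k₀ k : K) (s : List (Γ k₀)) :
    (if h : k = k₀ then (by rw [h]; exact s : List (Γ k)) else []) =
      update (fun _ => []) k₀ s k := by
  by_cases h : k = k₀
  · subst h; simp
  · simp [h]

/-- A function that is computed by a program in polynomial time is polynomial-time computable by
a Turing machine. -/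
theorem nonempty_polyTime [Fintype K] [∀ k, Finite (Γ k)] (P : Prog Γ) (k₀ k₁ : K)
    {α β : Type} (ea : α → List (Γ k₀)) (eb : β → List (Γ k₁)) (f : α → β) (p : Polynomial ℕ)
    (h : ∀ a, RunsIn P (update (fun _ => []) k₀ (ea a)) (update (fun _ => []) k₁ (eb (f a)))
      (p.eval (ea a).length)) :
    Nonempty (TM2ComputableInPolyTime ea eb f) := by
  refine ⟨⟨⟨P.toTM2 k₀ k₁, Equiv.refl _, Equiv.refl _⟩, p + 1, fun a => ?_⟩⟩
  have hn := h a
  refine ⟨⟨hn.choose + 1, ?_⟩, ?_⟩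
  · have e0 : initList (P.toTM2 k₀ k₁) (List.map id (ea a)) =
        ⟨some (some P.start), none, update (fun _ => []) k₀ (ea a)⟩ := by
      exact (congrArg (initList (P.toTM2 k₀ k₁)) (List.map_id (ea a))).trans
        (congrArg (TM2.Cfg.mk _ _) (funext fun k => dite_eq_update k₀ k (ea a)))
    have e1 : haltList (P.toTM2 k₀ k₁) (List.map id (eb (f a))) =
        ⟨none, none, update (fun _ => []) k₁ (eb (f a))⟩ := by
      exact (congrArg (haltList (P.toTM2 k₀ k₁)) (List.map_id (eb (f a)))).trans
        (congrArg (TM2.Cfg.mk _ _) (funext fun k => dite_eq_update k₁ k (eb (f a))))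
    have h1 := hn.choose_spec.2.iterate_toTM2 k₀ k₁ none
    exact (congrArg (fun x => (flip bind (P.toTM2 k₀ k₁).step)^[hn.choose + 1] (some x)) e0).trans
      (h1.trans (congrArg some e1).symm)
  · rw [Polynomial.eval_add, Polynomial.eval_one]
    exact Nat.add_le_add_right hn.choose_spec.1 1

end Compile

end StackProgram

/-! ### Values of payoff formulas -/

namespace ValuedPCSP

open Function

section Values

variable {S : Signature} {X Y : S.Srt → Type}

/-- All constraints of `Φ` have a finite payoff under `h`. -/
def IsFeasible (Φ : PayoffFormula S X) (A : ValuedStructure S) (h : SortedMap X A.Dom) : Prop :=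
  ∀ C ∈ Φ, A.payoff C.sym (C.args.comp h) ≠ ⊥

/-- The rational number `Φ^A(h)` for a feasible assignment `h`; infinite payoffs count as zero. -/
def value (Φ : PayoffFormula S X) (A : ValuedStructure S) (h : SortedMap X A.Dom) : ℚ :=
  (Φ.map fun C => (C.weight : ℚ) * (A.payoff C.sym (C.args.comp h)).unbotD 0).sum

theorem eval_of_isFeasible {Φ : PayoffFormula S X} {A : ValuedStructure S}
    {h : SortedMap X A.Dom} (hf : IsFeasible Φ A h) : eval Φ A h = (value Φ A h : ℚ) := by
  induction Φ with
  | nil => rfl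
  | cons C Φ ih =>
    have h1 := ih fun C' hC' => hf C' (List.mem_cons_of_mem _ hC')
    obtain ⟨q, hq⟩ := WithBot.ne_bot_iff_exists.1 (hf C List.mem_cons_self)
    simp only [eval, value, List.map_cons, List.sum_cons] at h1 ⊢
    rw [h1, ← hq]
    simp

theorem eval_of_not_isFeasible {Φ : PayoffFormula S X} {A : ValuedStructure S}
    {h : SortedMap X A.Dom} (hf : ¬IsFeasible Φ A h) : eval Φ A h = ⊥ := by
  induction Φ with
  | nil => simp [IsFeasible] at hf
  | cons C Φ ih =>
    simp only [eval, List.map_cons, List.sum_cons] at ih ⊢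
    by_cases hC : A.payoff C.sym (C.args.comp h) = ⊥
    · simp [hC]
    · rw [ih]
      · simp
      · intro h'
        refine hf fun C' hC' => ?_
        rcases List.mem_cons.1 hC' with rfl | hC'
        exacts [hC, h' C' hC']

theorem atLeast_iff {Φ : PayoffFormula S X} {A : ValuedStructure S} {h : SortedMap X A.Dom}
    {c : ℝ} : AtLeast Φ A h c ↔ IsFeasible Φ A h ∧ c * (totalWeight Φ : ℝ) ≤ (value Φ A h : ℝ) := by
  by_cases hf : IsFeasible Φ A h
  · simp only [AtLeast, toReal, eval_of_isFeasible hf, hf, true_and, WithBot.map_coe,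
      WithBot.coe_le_coe]
  · simp only [AtLeast, toReal, eval_of_not_isFeasible hf, hf, false_and, iff_false,
      WithBot.map_bot, le_bot_iff]
    exact WithBot.coe_ne_bot

theorem not_below_iff {Φ : PayoffFormula S X} {A : ValuedStructure S} {h : SortedMap X A.Dom}
    {c : ℝ} : ¬Below Φ A h c ↔ AtLeast Φ A h c := by
  rw [Below, AtLeast, not_lt]

/-- Rename the variables of a constraint. -/
def Constraint.map (g : SortedMap X Y) (C : Constraint S X) : Constraint S Y :=
  ⟨C.weight, C.sym, C.args.comp g⟩

theorem isFeasible_map {Φ : PayoffFormula S X} {A : ValuedStructure S} (g : SortedMap X Y)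
    (h : SortedMap Y A.Dom) :
    IsFeasible (Φ.map (Constraint.map g)) A h ↔ IsFeasible Φ A fun t x => h t (g t x) := by
  simp only [IsFeasible, List.forall_mem_map]
  rfl

theorem value_map {Φ : PayoffFormula S X} {A : ValuedStructure S} (g : SortedMap X Y)
    (h : SortedMap Y A.Dom) :
    value (Φ.map (Constraint.map g)) A h = value Φ A fun t x => h t (g t x) := by
  simp only [value, List.map_map]
  rfl

theorem totalWeight_map {Φ : PayoffFormula S X} (g : SortedMap X Y) :
    totalWeight (Φ.map (Constraint.map g)) = totalWeight Φ := by
  simp only [totalWeight, List.map_map]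
  rfl

theorem atLeast_map {Φ : PayoffFormula S X} {A : ValuedStructure S} (g : SortedMap X Y)
    (h : SortedMap Y A.Dom) {c : ℝ} :
    AtLeast (Φ.map (Constraint.map g)) A h c ↔ AtLeast Φ A (fun t x => h t (g t x)) c := by
  rw [atLeast_iff, atLeast_iff, isFeasible_map, value_map, totalWeight_map]

theorem isFeasible_append {Φ Ψ : PayoffFormula S X} {A : ValuedStructure S}
    {h : SortedMap X A.Dom} :
    IsFeasible (Φ ++ Ψ) A h ↔ IsFeasible Φ A h ∧ IsFeasible Ψ A h :=
  List.forall_mem_append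

theorem isFeasible_flatMap {ι : Type} {L : List ι} {Ψ : ι → PayoffFormula S X}
    {A : ValuedStructure S} {h : SortedMap X A.Dom} :
    IsFeasible (L.flatMap Ψ) A h ↔ ∀ i ∈ L, IsFeasible (Ψ i) A h := by
  simp only [IsFeasible, List.mem_flatMap]
  grind

theorem value_append {Φ Ψ : PayoffFormula S X} {A : ValuedStructure S}
    {h : SortedMap X A.Dom} : value (Φ ++ Ψ) A h = value Φ A h + value Ψ A h := by
  simp [value]

theorem value_flatMap {ι : Type} {L : List ι} {Ψ : ι → PayoffFormula S X}
    {A : ValuedStructure S} {h : SortedMap X A.Dom} :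
    value (L.flatMap Ψ) A h = (L.map fun i => value (Ψ i) A h).sum := by
  induction L with
  | nil => rfl
  | cons i L ih => rw [List.flatMap_cons, value_append, ih, List.map_cons, List.sum_cons]

theorem totalWeight_append {Φ Ψ : PayoffFormula S X} :
    totalWeight (Φ ++ Ψ) = totalWeight Φ + totalWeight Ψ := by
  simp [totalWeight]

theorem totalWeight_flatMap {ι : Type} {L : List ι} {Ψ : ι → PayoffFormula S X} :
    totalWeight (L.flatMap Ψ) = (L.map fun i => totalWeight (Ψ i)).sum := by
  induction L with
  | nil => rfl
  | cons i L ih => rw [List.flatMap_cons, totalWeight_append, ih, List.map_cons, List.sum_cons]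

theorem value_eq_zero {Φ : PayoffFormula S X} {A : ValuedStructure S} {h : SortedMap X A.Dom}
    (hΦ : ∀ C ∈ Φ, C.weight = 0) : value Φ A h = 0 := by
  refine List.sum_eq_zero ?_
  simp only [List.mem_map]
  rintro _ ⟨C, hC, rfl⟩
  simp [hΦ C hC]

theorem totalWeight_eq_zero {Φ : PayoffFormula S X} (hΦ : ∀ C ∈ Φ, C.weight = 0) :
    totalWeight Φ = 0 := by
  refine List.sum_eq_zero ?_
  simp only [List.mem_map]
  rintro _ ⟨C, hC, rfl⟩
  exact hΦ C hC

end Values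

/-! ### Rational slopes and integral weights -/

section Slopes

/-- A finite system of inequalities `α x + t ≤ p` with rational `x` and `p` that has a nonnegative
real solution `α` has a nonnegative rational solution. At an irrational solution all tight lines
coincide, so that `α` can be moved slightly in the direction favoured by their common slope. -/
theorem exists_rat_slope {J : Type} [Finite J] (x p : J → ℚ) (α₀ t : ℝ) (h₀ : 0 ≤ α₀)
    (h : ∀ j, α₀ * (x j : ℝ) + t ≤ (p j : ℝ)) :
    ∃ α : ℚ≥0, ∀ j, (α : ℝ) * (x j : ℝ) + t ≤ (p j : ℝ) := by
  by_cases hα : ∃ q : ℚ, (q : ℝ) = α₀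
  · obtain ⟨q, rfl⟩ := hα
    lift q to ℚ≥0 using by exact_mod_cast h₀
    exact ⟨q, by exact_mod_cast h⟩
  rcases isEmpty_or_nonempty J with hJ | hJ
  · exact ⟨0, fun j => hJ.elim j⟩
  have hpos : 0 < α₀ := lt_of_le_of_ne h₀ fun h => hα ⟨0, by simpa using h⟩
  obtain ⟨i, hi⟩ := Finite.exists_min fun j => (p j : ℝ) - α₀ * (x j : ℝ)
  have hev : ∀ᶠ a : ℝ in nhds α₀,
      0 < a ∧ ∀ j, (p i : ℝ) - a * (x i : ℝ) ≤ (p j : ℝ) - a * (x j : ℝ) := by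
    refine (lt_mem_nhds hpos).and (Filter.eventually_all.2 fun j => ?_)
    rcases (hi j).lt_or_eq with hlt | heq
    · have h1 : ContinuousAt (fun a : ℝ => (p i : ℝ) - a * (x i : ℝ)) α₀ := by fun_prop
      have h2 : ContinuousAt (fun a : ℝ => (p j : ℝ) - a * (x j : ℝ)) α₀ := by fun_prop
      exact (h1.eventually_lt h2 hlt).mono fun a ha => ha.le
    · have hx : x i = x j := by
        by_contra hne
        have hne' : (x i : ℝ) - x j ≠ 0 := by
          rw [sub_ne_zero]; exact_mod_cast hne
        refine hα ⟨(p i - p j) / (x i - x j), ?_⟩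
        push_cast
        rw [div_eq_iff hne']
        linarith
      have hp : (p i : ℝ) = p j := by rw [hx] at heq; linarith
      filter_upwards with a
      rw [hx, hp]
  obtain ⟨δ, hδ, hball⟩ := Metric.eventually_nhds_iff.1 hev
  have key : ∀ q : ℚ, |(q : ℝ) - α₀| < δ → (q : ℝ) * (x i : ℝ) ≤ α₀ * (x i : ℝ) →
      ∃ α : ℚ≥0, ∀ j, (α : ℝ) * (x j : ℝ) + t ≤ (p j : ℝ) := by
    intro q hq hle
    obtain ⟨hq0, hqj⟩ := hball (y := (q : ℝ)) (by rwa [Real.dist_eq])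
    lift q to ℚ≥0 using by exact_mod_cast hq0.le
    refine ⟨q, fun j => ?_⟩
    have h1 := h i
    have h2 := hqj j
    have e : ((q : ℚ) : ℝ) = (q : ℝ) := by norm_cast
    rw [e] at h2 hle
    linarith
  rcases le_total 0 (x i) with hx | hx
  · obtain ⟨q, hq1, hq2⟩ := exists_rat_btwn (show α₀ - δ < α₀ by linarith)
    refine key q (by rw [abs_lt]; constructor <;> linarith) ?_
    exact mul_le_mul_of_nonneg_right hq2.le (by exact_mod_cast hx)
  · obtain ⟨q, hq1, hq2⟩ := exists_rat_btwn (show α₀ < α₀ + δ by linarith)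
    refine key q (by rw [abs_lt]; constructor <;> linarith) ?_
    exact mul_le_mul_of_nonpos_right hq1.le (by exact_mod_cast hx)

theorem exists_common_denominator (l : List ℚ≥0) :
    ∃ R : ℕ, 0 < R ∧ ∀ q ∈ l, ∃ n : ℕ, (n : ℚ≥0) = R * q := by
  induction l with
  | nil => exact ⟨1, one_pos, by simp⟩
  | cons q l ih =>
    obtain ⟨R, hR, h⟩ := ih
    refine ⟨R * q.den, Nat.mul_pos hR q.den_pos, ?_⟩
    intro q' hq'
    rcases List.mem_cons.1 hq' with rfl | hq'
    · refine ⟨R * q'.num, ?_⟩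
      push_cast
      rw [mul_assoc, NNRat.den_mul_eq_num]
    · obtain ⟨n, hn⟩ := h q' hq'
      exact ⟨n * q.den, by push_cast; rw [hn]; ring⟩

end Slopes

/-! ### Expected values -/

section Expectation

variable {N : Type} [Fintype N]

theorem FinDist.expect_mul (μ : FinDist N) (w : ℚ) (f : N → ℚ) :
    μ.expect (fun n => w * f n) = w * μ.expect f := by
  simp only [FinDist.expect, Finset.mul_sum]
  exact Finset.sum_congr rfl fun n _ => by ring

theorem FinDist.exists_expect_le (μ : FinDist N) (f : N → ℚ) : ∃ n, μ.expect f ≤ f n := by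
  have h1 : ∑ n, (μ.1 n : ℚ) = 1 := by exact_mod_cast congrArg (NNRat.cast (K := ℚ)) μ.2
  have hN : Nonempty N := by
    by_contra hN
    rw [not_nonempty_iff] at hN
    simp at h1
  obtain ⟨m, hm⟩ := Finite.exists_max f
  refine ⟨m, ?_⟩
  calc μ.expect f ≤ ∑ n, (μ.1 n : ℚ) * f m :=
        Finset.sum_le_sum fun n _ => mul_le_mul_of_nonneg_left (hm n) (NNRat.cast_nonneg _)
    _ = f m := by rw [← Finset.sum_mul, h1, one_mul]

/-- If every variable `x` is given a random label with distribution `μ x`, and every summand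
depends on the label of one variable only, then some fixed labelling does at least as well as the
expected value. -/
theorem exists_labelling {X ι : Type} [Fintype X] (μ : X → FinDist N) (L : List ι)
    (key : ι → X) (G : ι → N → ℚ) :
    ∃ d : X → N, (L.map fun i => (μ (key i)).expect (G i)).sum ≤
      (L.map fun i => G i (d (key i))).sum := by
  classical
  choose d hd using fun x => (μ x).exists_expect_le fun n =>
    (L.map fun i => if key i = x then G i n else 0).sum
  refine ⟨d, ?_⟩
  have regroup : ∀ (L : List ι) (F : ι → X → ℚ),
      (L.map fun i => F i (key i)).sum =
        ∑ x, (L.map fun i => if key i = x then F i x else 0).sum := by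
    intro L F
    induction L with
    | nil => simp
    | cons i L ih => simp [ih, Finset.sum_add_distrib]
  have expect_sum : ∀ (L : List ι) (x : X),
      ((μ x).expect fun n => (L.map fun i => if key i = x then G i n else 0).sum) =
        (L.map fun i => if key i = x then (μ x).expect (G i) else 0).sum := by
    intro L x
    induction L with
    | nil => simp [FinDist.expect]
    | cons i L ih =>
      rw [List.map_cons, List.sum_cons, ← ih]
      simp only [FinDist.expect, List.map_cons, List.sum_cons, mul_add, Finset.sum_add_distrib]
      by_cases h : key i = x <;> simp [h]
  rw [regroup L fun i x => (μ x).expect (G i), regroup L fun i x => G i (d x)]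
  refine Finset.sum_le_sum fun x _ => ?_
  rw [← expect_sum]
  exact hd x

end Expectation

end ValuedPCSP

/-! ### The reduced instance -/

namespace ValuedPCSP

open Function

section Patterns

variable {S : Signature} {X : S.Srt → Type}

/-- A constraint without its weight: a flag tells whether it is to be given the weight of the
input constraint that it replaces, or the weight zero. -/
structure Pattern (S : Signature) (X : S.Srt → Type) where
  /-- whether the constraint has a nonzero weight -/
  weighted : Bool
  /-- the relation symbol -/
  sym : S.Rel
  /-- the tuple of variables -/
  args : Tuple S X sym

/-- The constraint obtained from a pattern and a weight. -/
def Pattern.weigh (w : ℚ≥0) (m : Pattern S X) : Constraint S X :=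
  ⟨if m.weighted then w else 0, m.sym, m.args⟩

/-- Every constraint `C` of `Φ` is replaced by `mult C` weighted copies. An additional copy of
weight zero keeps the feasibility requirement of `C` when `mult C = 0`. -/
def copies (mult : Constraint S X → ℕ) (Φ : PayoffFormula S X) : List (Pattern S X) :=
  Φ.flatMap fun C => ⟨false, C.sym, C.args⟩ :: List.replicate (mult C) ⟨true, C.sym, C.args⟩

theorem isFeasible_copies {mult : Constraint S X → ℕ} {Φ : PayoffFormula S X} {w : ℚ≥0}
    {A : ValuedStructure S} {h : SortedMap X A.Dom} :
    IsFeasible ((copies mult Φ).map (Pattern.weigh w)) A h ↔ IsFeasible Φ A h := by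
  simp only [IsFeasible, copies, List.forall_mem_map, List.mem_flatMap, List.mem_cons,
    List.mem_replicate, Pattern.weigh]
  constructor
  · intro H C hC
    exact H ⟨false, C.sym, C.args⟩ ⟨C, hC, Or.inl rfl⟩
  · rintro H m ⟨C, hC, rfl | ⟨-, rfl⟩⟩ <;> exact H C hC

theorem value_copies {mult : Constraint S X → ℕ} {Φ : PayoffFormula S X} {w r : ℚ≥0}
    (hr : ∀ C ∈ Φ, (mult C : ℚ≥0) = r * C.weight) {A : ValuedStructure S}
    {h : SortedMap X A.Dom} :
    value ((copies mult Φ).map (Pattern.weigh w)) A h = w * r * value Φ A h := by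
  induction Φ with
  | nil => simp [copies, value]
  | cons C Φ ih =>
    have ih' := ih fun C' hC' => hr C' (List.mem_cons_of_mem _ hC')
    have hC : (mult C : ℚ) = r * C.weight := by exact_mod_cast hr C List.mem_cons_self
    simp only [copies, value, List.flatMap_cons, List.map_append, List.sum_append, List.map_cons,
      List.sum_cons, Pattern.weigh, List.map_replicate, List.sum_replicate, if_true] at ih' ⊢
    rw [ih', nsmul_eq_mul, hC]
    simp
    ring

theorem totalWeight_copies {mult : Constraint S X → ℕ} {Φ : PayoffFormula S X} {w r : ℚ≥0}
    (hr : ∀ C ∈ Φ, (mult C : ℚ≥0) = r * C.weight) :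
    totalWeight ((copies mult Φ).map (Pattern.weigh w)) = w * r * totalWeight Φ := by
  induction Φ with
  | nil => simp [copies, totalWeight]
  | cons C Φ ih =>
    have ih' := ih fun C' hC' => hr C' (List.mem_cons_of_mem _ hC')
    have hC := hr C List.mem_cons_self
    simp only [copies, totalWeight, List.flatMap_cons, List.map_append, List.sum_append,
      List.map_cons, List.sum_cons, Pattern.weigh, List.map_replicate, List.sum_replicate,
      if_true] at ih' ⊢
    rw [ih', nsmul_eq_mul, hC]
    simp
    ring

open Classical in
/-- The constraints of weight zero that express that a sorted map on `A^N` is a polymorphism: one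
for every matrix over `A` all of whose columns have a finite payoff. -/
noncomputable def polPatterns (A : ValuedStructure S) (N : Type) [Finite N] :
    List (Pattern S (Pow A.Dom N)) :=
  ((enum (Σ φ : S.Rel, Tuple S (Pow A.Dom N) φ)).filter fun m =>
    ∀ n : N, A.payoff m.1 (m.2.comp (proj A.Dom n)) ≠ ⊥).map fun m => ⟨false, m.1, m.2⟩

theorem isFeasible_polPatterns {A B : ValuedStructure S} {N : Type} [Finite N] {w : ℚ≥0}
    {f : SortedMap (Pow A.Dom N) B.Dom} :
    IsFeasible ((polPatterns A N).map (Pattern.weigh w)) B f ↔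
      IsPolymorphism A.feas B.feas f := by
  simp only [IsFeasible, polPatterns, List.forall_mem_map, Pattern.weigh, List.mem_filter,
    mem_enum, true_and, decide_eq_true_eq, IsPolymorphism]
  exact ⟨fun H φ M hM => H ⟨φ, M⟩ hM, fun H m hm => H m.1 m.2 hm⟩

theorem weight_polPatterns {A : ValuedStructure S} {N : Type} [Finite N] {w : ℚ≥0} :
    ∀ C ∈ (polPatterns A N).map (Pattern.weigh w), C.weight = 0 := by
  simp only [polPatterns, List.forall_mem_map, Pattern.weigh, Bool.false_eq_true, if_false,
    implies_true]

theorem isPolymorphism_proj (A : ValuedStructure S) {N : Type} (n : N) :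
    IsPolymorphism A.feas A.feas (proj A.Dom n) :=
  fun _ _ hM => hM n

end Patterns

section Blocks

variable {S : Signature} {D E : Type} {A B : ValuedStructure S}

/-- The variables of the reduced instance: a copy of `A^D` for each left variable and a copy
of `A^E` for each right variable. -/
abbrev BlockVars (A : ValuedStructure S) (D E : Type) (n : Side → ℕ) : S.Srt → Type :=
  fun t => (Fin (n .left) × Pow A.Dom D t) ⊕ (Fin (n .right) × Pow A.Dom E t)

/-- The inclusion of the block of the left variable `x`. -/
def leftBlock (n : Side → ℕ) (x : Fin (n .left)) :
    SortedMap (Pow A.Dom D) (BlockVars A D E n) :=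
  fun _ a => .inl (x, a)

/-- The inclusion of the block of the right variable `y`. -/
def rightBlock (n : Side → ℕ) (y : Fin (n .right)) :
    SortedMap (Pow A.Dom E) (BlockVars A D E n) :=
  fun _ a => .inr (y, a)

/-- The inclusion of the blocks of the variables `x` and `y`. -/
def pairBlock (n : Side → ℕ) (x : Fin (n .left)) (y : Fin (n .right)) :
    SortedMap (PairVars A.Dom D E) (BlockVars A D E n) :=
  pairMap (leftBlock n x) (rightBlock n y)

/-- The functions on the left blocks of an assignment. -/
def leftPart {n : Side → ℕ} (h : SortedMap (BlockVars A D E n) B.Dom) (x : Fin (n .left)) :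
    SortedMap (Pow A.Dom D) B.Dom :=
  fun t a => h t (.inl (x, a))

/-- The functions on the right blocks of an assignment. -/
def rightPart {n : Side → ℕ} (h : SortedMap (BlockVars A D E n) B.Dom) (y : Fin (n .right)) :
    SortedMap (Pow A.Dom E) B.Dom :=
  fun t a => h t (.inr (y, a))

theorem comp_pairBlock {n : Side → ℕ} (h : SortedMap (BlockVars A D E n) B.Dom)
    (x : Fin (n .left)) (y : Fin (n .right)) :
    (fun t v => h t (pairBlock n x y t v)) = pairMap (leftPart h x) (rightPart h y) := by
  funext t v
  cases v <;> rfl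

end Blocks

section Casts

theorem labelPayoff_le_one {D E : Type} (π : D → E) (d : D) (e : E) : labelPayoff π d e ≤ 1 := by
  unfold labelPayoff
  split_ifs <;> norm_num

theorem cast_mul_cast_le_cast (c : ℚ) (a : ℚ≥0) (b : ℚ) :
    (c : ℝ) * (a : ℝ) ≤ (b : ℝ) ↔ c * (a : ℚ) ≤ b := by
  norm_cast

end Casts

section Reduction

variable {S : Signature} {D E : Type} [Finite D] [Finite E] {A B : ValuedStructure S}

/-- The reduced formula. The function on every block is forced to be a polymorphism, and every
input constraint of nonzero weight is replaced by the patterns of its label. -/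
noncomputable def blockFormula (pat : (D → E) → List (Pattern S (PairVars A.Dom D E)))
    (I : Instance (glcSignature D E)) : PayoffFormula S (BlockVars A D E I.numVars) :=
  ((List.finRange (I.numVars .left)).flatMap fun x =>
      ((polPatterns A D).map (Pattern.weigh 0)).map (Constraint.map (leftBlock I.numVars x))) ++
    (((List.finRange (I.numVars .right)).flatMap fun y =>
      ((polPatterns A E).map (Pattern.weigh 0)).map (Constraint.map (rightBlock I.numVars y))) ++
    I.formula.flatMap fun C => if C.weight = 0 then [] else
      ((pat C.sym).map (Pattern.weigh C.weight)).map
        (Constraint.map (pairBlock I.numVars (C.args Side.left) (C.args Side.right))))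

variable {Φ : (D → E) → PayoffFormula S (PairVars A.Dom D E)}
  {mult : (D → E) → Constraint S (PairVars A.Dom D E) → ℕ} {r : (D → E) → ℚ≥0}

theorem isFeasible_blockFormula {I : Instance (glcSignature D E)}
    {h : SortedMap (BlockVars A D E I.numVars) B.Dom} :
    IsFeasible (blockFormula (fun π => copies (mult π) (Φ π)) I) B h ↔
      (∀ x, IsPolymorphism A.feas B.feas (leftPart h x)) ∧
      (∀ y, IsPolymorphism A.feas B.feas (rightPart h y)) ∧
      ∀ C ∈ I.formula, C.weight ≠ 0 → IsFeasible (Φ C.sym) B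
        (pairMap (leftPart h (C.args Side.left)) (rightPart h (C.args Side.right))) := by
  have h3 : ∀ C : Constraint (glcSignature D E) fun t => Fin (I.numVars t),
      IsFeasible (if C.weight = 0 then [] else
        ((copies (mult C.sym) (Φ C.sym)).map (Pattern.weigh C.weight)).map
        (Constraint.map (pairBlock I.numVars (C.args Side.left) (C.args Side.right)))) B h ↔
      (C.weight ≠ 0 → IsFeasible (Φ C.sym) B
        (pairMap (leftPart h (C.args Side.left)) (rightPart h (C.args Side.right)))) := by
    intro C
    by_cases hC : C.weight = 0
    · simp [hC, IsFeasible]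
    · rw [if_neg hC, isFeasible_map, comp_pairBlock, isFeasible_copies]
      simp [hC]
  have h1 : ∀ x, IsFeasible (((polPatterns A D).map (Pattern.weigh 0)).map
      (Constraint.map (leftBlock (E := E) I.numVars x))) B h ↔
      IsPolymorphism A.feas B.feas (leftPart h x) := by
    intro x
    rw [isFeasible_map, ← isFeasible_polPatterns (w := 0)]
    rfl
  have h2 : ∀ y, IsFeasible (((polPatterns A E).map (Pattern.weigh 0)).map
      (Constraint.map (rightBlock (D := D) I.numVars y))) B h ↔
      IsPolymorphism A.feas B.feas (rightPart h y) := by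
    intro y
    rw [isFeasible_map, ← isFeasible_polPatterns (w := 0)]
    rfl
  simp only [blockFormula, isFeasible_append, isFeasible_flatMap, h1, h2, h3, List.mem_finRange,
    true_imp_iff]

theorem value_blockFormula (hr : ∀ π, ∀ C ∈ Φ π, (mult π C : ℚ≥0) = r π * C.weight)
    {I : Instance (glcSignature D E)} {h : SortedMap (BlockVars A D E I.numVars) B.Dom} :
    value (blockFormula (fun π => copies (mult π) (Φ π)) I) B h =
      (I.formula.map fun C => (C.weight : ℚ) * r C.sym * value (Φ C.sym) B
        (pairMap (leftPart h (C.args Side.left)) (rightPart h (C.args Side.right)))).sum := by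
  rw [blockFormula, value_append, value_append, value_eq_zero, value_eq_zero, zero_add, zero_add,
    value_flatMap]
  · congr 1
    refine List.map_congr_left fun C _ => ?_
    by_cases hC : C.weight = 0
    · simp [hC, value]
    · rw [if_neg hC, value_map, comp_pairBlock, value_copies (hr C.sym)]
  all_goals
    simp only [List.mem_flatMap, List.mem_map]
    rintro _ ⟨x, -, C, ⟨m, hm, rfl⟩, rfl⟩
    exact weight_polPatterns (w := 0) _ (List.mem_map.2 ⟨m, hm, rfl⟩)

theorem totalWeight_blockFormula (hΦ : ∀ π, totalWeight (Φ π) = 1)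
    (hr : ∀ π, ∀ C ∈ Φ π, (mult π C : ℚ≥0) = r π * C.weight)
    {I : Instance (glcSignature D E)} :
    totalWeight (blockFormula (fun π => copies (mult π) (Φ π)) I) =
      (I.formula.map fun C => C.weight * r C.sym).sum := by
  rw [blockFormula, totalWeight_append, totalWeight_append, totalWeight_eq_zero,
    totalWeight_eq_zero, zero_add, zero_add, totalWeight_flatMap]
  · congr 1
    refine List.map_congr_left fun C _ => ?_
    by_cases hC : C.weight = 0
    · simp [hC, totalWeight]
    · rw [if_neg hC, totalWeight_map, totalWeight_copies (hr C.sym), hΦ, mul_one]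
  all_goals
    simp only [List.mem_flatMap, List.mem_map]
    rintro _ ⟨x, -, C, ⟨m, hm, rfl⟩, rfl⟩
    exact weight_polPatterns (w := 0) _ (List.mem_map.2 ⟨m, hm, rfl⟩)

/-! ### Completeness and soundness -/

/-- An assignment of labels, given separately on the two sides. -/
def labels {n : Side → ℕ} (d : Fin (n .left) → D) (e : Fin (n .right) → E) :
    SortedMap (fun t => Fin (n t)) (glcStructure D E).Dom
  | .left => d
  | .right => e

theorem glc_atLeast_iff {I : Instance (glcSignature D E)}
    {g : SortedMap (fun t => Fin (I.numVars t)) (glcStructure D E).Dom} {c : ℝ} :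
    AtLeast I.formula (glcStructure D E) g c ↔
      c * ((I.formula.map Constraint.weight).sum : ℚ≥0) ≤
        ((I.formula.map fun C => (C.weight : ℚ) * labelPayoff C.sym
          (g .left (C.args Side.left)) (g .right (C.args Side.right))).sum : ℚ) := by
  rw [atLeast_iff, and_iff_right]
  · rfl
  · intro C _
    exact WithBot.coe_ne_bot

/-- A labelling that attains the total weight satisfies every constraint of nonzero weight. -/
theorem apply_eq_of_glc_atLeast_one {I : Instance (glcSignature D E)}
    {g : SortedMap (fun t => Fin (I.numVars t)) (glcStructure D E).Dom}
    (h : AtLeast I.formula (glcStructure D E) g 1)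
    {C : Constraint (glcSignature D E) fun t => Fin (I.numVars t)} (hC : C ∈ I.formula)
    (hw : C.weight ≠ 0) : C.sym (g .left (C.args Side.left)) = g .right (C.args Side.right) := by
  rw [glc_atLeast_iff, ← Rat.cast_one, cast_mul_cast_le_cast, one_mul] at h
  have h' : ((I.formula.map fun C => (C.weight : ℚ)).sum : ℚ) ≤
      (I.formula.map fun C => (C.weight : ℚ) * labelPayoff C.sym
          (g .left (C.args Side.left)) (g .right (C.args Side.right))).sum := by
    have e : ((I.formula.map Constraint.weight).sum : ℚ≥0) =
        ((I.formula.map fun C => (C.weight : ℚ)).sum : ℚ) := by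
      push_cast
      simp [List.map_map, Function.comp_def]
    rwa [← e]
  by_contra hne
  refine absurd h' (not_le.2 ?_)
  refine List.sum_lt_sum _ _ (fun C _ => ?_) ⟨C, hC, ?_⟩
  · exact mul_le_of_le_one_right (NNRat.cast_nonneg _) (labelPayoff_le_one _ _ _)
  · have : labelPayoff C.sym (g .left (C.args Side.left)) (g .right (C.args Side.right)) = 0 :=
      if_neg hne
    exact (mul_eq_zero_of_right _ this).trans_lt (by exact_mod_cast pos_iff_ne_zero.2 hw)

/-- Completeness: on the block of a variable with the label `d`, the assignment is the projection
to the coordinate `d`, which is a polymorphism. -/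
theorem exists_atLeast_blockFormula {c : ℚ} (hΦ : ∀ π, totalWeight (Φ π) = 1)
    (hr : ∀ π, ∀ C ∈ Φ π, (mult π C : ℚ≥0) = r π * C.weight)
    (hcomplete : ∀ (π : D → E) (d : D),
      ((c : ℚ) : WithBot ℚ) ≤ eval (Φ π) A (pairMap (proj A.Dom d) (proj A.Dom (π d))))
    {I : Instance (glcSignature D E)}
    (hI : ∃ g, AtLeast I.formula (glcStructure D E) g 1) :
    ∃ h, AtLeast (blockFormula (fun π => copies (mult π) (Φ π)) I) A h c := by
  obtain ⟨g, hg⟩ := hI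
  have hcomp : ∀ (π : D → E) (d : D),
      IsFeasible (Φ π) A (pairMap (proj A.Dom d) (proj A.Dom (π d))) ∧
      c ≤ value (Φ π) A (pairMap (proj A.Dom d) (proj A.Dom (π d))) := by
    intro π d
    have := hcomplete π d
    by_cases hf : IsFeasible (Φ π) A (pairMap (proj A.Dom d) (proj A.Dom (π d)))
    · rw [eval_of_isFeasible hf] at this
      exact ⟨hf, by exact_mod_cast this⟩
    · rw [eval_of_not_isFeasible hf, le_bot_iff] at this
      exact absurd this WithBot.coe_ne_bot
  let h : SortedMap (BlockVars A D E I.numVars) A.Dom := fun t =>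
    Sum.elim (fun v => v.2 (g .left v.1)) fun v => v.2 (g .right v.1)
  have hl : ∀ x, leftPart h x = proj A.Dom (g .left x : D) := fun x => rfl
  have hr' : ∀ y, rightPart h y = proj A.Dom (g .right y : E) := fun y => rfl
  refine ⟨h, atLeast_iff.2 ⟨isFeasible_blockFormula.2 ⟨fun x => ?_, fun y => ?_, ?_⟩, ?_⟩⟩
  · rw [hl]
    exact isPolymorphism_proj A _
  · rw [hr']
    exact isPolymorphism_proj A _
  · intro C hC hw
    rw [hl, hr', ← apply_eq_of_glc_atLeast_one hg hC hw]
    exact (hcomp _ _).1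
  · rw [value_blockFormula hr, totalWeight_blockFormula hΦ hr]
    have : c * ((I.formula.map fun C => C.weight * r C.sym).sum : ℚ≥0) ≤
        (I.formula.map fun C => (C.weight : ℚ) * r C.sym * value (Φ C.sym) A
        (pairMap (leftPart h (C.args Side.left)) (rightPart h (C.args Side.right)))).sum := by
      push_cast
      rw [List.map_map, ← List.sum_map_mul_left]
      refine List.sum_le_sum fun C hC => ?_
      by_cases hw : C.weight = 0
      · simp [hw]
      · rw [hl, hr', ← apply_eq_of_glc_atLeast_one hg hC hw]
        simp only [comp_apply, NNRat.cast_mul]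
        rw [mul_comm]
        exact mul_le_mul_of_nonneg_left (hcomp _ _).2 (by positivity)
    exact (cast_mul_cast_le_cast _ _ _).2 this

end Reduction

section Soundness

variable {S : Signature} {D E : Type} [Fintype D] [Fintype E] {A B : ValuedStructure S}
  {Φ : (D → E) → PayoffFormula S (PairVars A.Dom D E)}
  {mult : (D → E) → Constraint S (PairVars A.Dom D E) → ℕ} {R : ℕ} {α : (D → E) → ℚ≥0}

/-- Some labelling does at least as well as independent random labels. -/
theorem exists_labels_expect_le {I : Instance (glcSignature D E)}
    (μ : Fin (I.numVars .left) → FinDist D) (ν : Fin (I.numVars .right) → FinDist E) :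
    ∃ (d : Fin (I.numVars .left) → D) (e : Fin (I.numVars .right) → E),
      (I.formula.map fun C => (C.weight : ℚ) * (μ (C.args Side.left)).expect fun d =>
        (ν (C.args Side.right)).expect fun e => labelPayoff C.sym d e).sum ≤
      (I.formula.map fun C => (C.weight : ℚ) *
        labelPayoff C.sym (d (C.args Side.left)) (e (C.args Side.right))).sum := by
  obtain ⟨d, hd⟩ := exists_labelling μ I.formula (fun C => C.args Side.left) fun C d =>
    (C.weight : ℚ) * (ν (C.args Side.right)).expect fun e => labelPayoff C.sym d e
  obtain ⟨e, he⟩ := exists_labelling ν I.formula (fun C => C.args Side.right) fun C e =>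
    (C.weight : ℚ) * labelPayoff C.sym (d (C.args Side.left)) e
  simp only [FinDist.expect_mul] at hd he
  exact ⟨d, e, hd.trans he⟩

/-- Soundness: the functions on the blocks are polymorphisms, and random labels are drawn from the
distributions assigned to them. The expected payoff of these labels is bounded from below by
summing up the linear inequalities `hsound`, and some fixed labels attain it. -/
theorem exists_glc_atLeast {s : ℚ} {ε : ℝ} (hΦ : ∀ π, totalWeight (Φ π) = 1) (hR : 0 < R)
    (hr : ∀ π, ∀ C ∈ Φ π, (mult π C : ℚ≥0) = (R * α π) * C.weight)
    (LD : PolFeas A B D → FinDist D) (LE : PolFeas A B E → FinDist E)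
    (hsound : ∀ (π : D → E) (fD : PolFeas A B D) (fE : PolFeas A B E),
      IsFeasible (Φ π) B (pairMap fD.1 fE.1) →
      (α π : ℝ) * ((value (Φ π) B (pairMap fD.1 fE.1) - s : ℚ) : ℝ) + ε ≤
        (((LD fD).expect fun d => (LE fE).expect fun e => labelPayoff π d e : ℚ) : ℝ))
    {I : Instance (glcSignature D E)}
    (hI : ∃ h, AtLeast (blockFormula (fun π => copies (mult π) (Φ π)) I) B h s) :
    ∃ g, AtLeast I.formula (glcStructure D E) g ε := by
  obtain ⟨h, hh⟩ := hI
  obtain ⟨hf, hv⟩ := atLeast_iff.1 hh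
  obtain ⟨hl, hr', hc⟩ := isFeasible_blockFormula.1 hf
  rw [value_blockFormula hr, totalWeight_blockFormula hΦ hr] at hv
  obtain ⟨d, e, hde⟩ := exists_labels_expect_le (I := I) (fun x => LD ⟨_, hl x⟩)
    fun y => LE ⟨_, hr' y⟩
  refine ⟨labels d e, glc_atLeast_iff.2 (le_trans ?_ (Rat.cast_le.2 hde))⟩
  have hR' : (0 : ℝ) < R := by exact_mod_cast hR
  refine le_of_mul_le_mul_left ?_ hR'
  have hcast : ∀ l : List ℚ, ((l.sum : ℚ) : ℝ) = (l.map fun q : ℚ => (q : ℝ)).sum := by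
    intro l; push_cast; rfl
  have hcast' : ∀ l : List ℚ≥0, ((l.sum : ℚ≥0) : ℝ) = (l.map fun q : ℚ≥0 => (q : ℝ)).sum := by
    intro l; push_cast; rfl
  rw [hcast, hcast', List.map_map, List.map_map, ← List.sum_map_mul_left] at hv
  rw [hcast, hcast', List.map_map, List.map_map, ← List.sum_map_mul_left,
    ← List.sum_map_mul_left, ← List.sum_map_mul_left]
  refine le_of_add_le_add_left (le_trans (add_le_add_left hv _) ?_)
  rw [← List.sum_map_add, ← List.sum_map_add]
  refine List.sum_le_sum fun C hC => ?_
  by_cases hw : C.weight = 0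
  · simp [hw]
  · have := hsound C.sym ⟨_, hl (C.args Side.left)⟩ ⟨_, hr' (C.args Side.right)⟩ (hc C hC hw)
    have := mul_le_mul_of_nonneg_left this (show (0 : ℝ) ≤ R * (C.weight : ℝ) by positivity)
    simp only [comp_apply]
    push_cast at this ⊢
    linarith

end Soundness

end ValuedPCSP

/-! ### The memory of the reduction program -/

namespace ValuedPCSP

open Function StackProgram

/-- Unary counters: the number of variables on a side, and the position of the variable on this
side that is currently processed. -/
inductive Counter : Type
  | total (z : Side)
  | pos (z : Side)

/-- The stacks of the reduction program. -/
inductive Store : Type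
  /-- the input -/
  | inp
  /-- a buffer for the input -/
  | rest
  /-- the output -/
  | out
  /-- the output produced so far, with its last letter on top -/
  | acc
  /-- the numerator (`true`) and the denominator (`false`) of the current weight, reversed -/
  | wt (b : Bool)
  /-- a buffer for weights -/
  | bits
  /-- the counters -/
  | ctr (c : Counter)
  /-- a buffer for counters -/
  | tick

instance : Finite Side := finite_side

instance : Finite Counter :=
  Finite.of_surjective (fun x : Side ⊕ Side => x.elim Counter.total Counter.pos) (by
    rintro (z | z)
    exacts [⟨.inl z, rfl⟩, ⟨.inr z, rfl⟩])

instance : Finite Store := by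
  let g : Fin 6 ⊕ Bool ⊕ Counter → Store := fun x =>
    match x with
    | .inl 0 => .inp
    | .inl 1 => .rest
    | .inl 2 => .out
    | .inl 3 => .acc
    | .inl 4 => .bits
    | .inl 5 => .tick
    | .inr (.inl b) => .wt b
    | .inr (.inr c) => .ctr c
  refine Finite.of_surjective g ?_
  rintro (_ | _ | _ | _ | b | _ | c | _)
  exacts [⟨.inl 0, rfl⟩, ⟨.inl 1, rfl⟩, ⟨.inl 2, rfl⟩, ⟨.inl 3, rfl⟩, ⟨.inr (.inl b), rfl⟩,
    ⟨.inl 4, rfl⟩, ⟨.inr (.inr c), rfl⟩, ⟨.inl 5, rfl⟩]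

noncomputable instance : DecidableEq Store := Classical.decEq _
noncomputable instance : DecidableEq Counter := Classical.decEq _
noncomputable instance : DecidableEq Side := Classical.decEq _

/-- The alphabets of the stacks. -/
def Alphabet (S T : Signature) : Store → Type
  | .inp => Letter T
  | .rest => Letter T
  | .out => Letter S
  | .acc => Letter S
  | .wt _ => Bool
  | .bits => Bool
  | .ctr _ => Unit
  | .tick => Unit

instance (S T : Signature) : ∀ k, Finite (Alphabet S T k)
  | .inp => finite_letter T
  | .rest => finite_letter T
  | .out => finite_letter S
  | .acc => finite_letter S
  | .wt _ => inferInstanceAs (Finite Bool)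
  | .bits => inferInstanceAs (Finite Bool)
  | .ctr _ => inferInstanceAs (Finite Unit)
  | .tick => inferInstanceAs (Finite Unit)

/-- The contents of the stacks, with numbers in place of unary words. -/
@[ext]
structure Memory (S T : Signature) where
  /-- the input -/
  inp : List (Letter T)
  /-- the buffer for the input -/
  rest : List (Letter T)
  /-- the output -/
  out : List (Letter S)
  /-- the output produced so far, reversed -/
  acc : List (Letter S)
  /-- the numerator and the denominator of the current weight, reversed -/
  wt : Bool → List Bool
  /-- the buffer for weights -/
  bits : List Bool
  /-- the counters -/
  ctr : Counter → ℕ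
  /-- the buffer for counters -/
  tick : ℕ

section Memory

variable {S T : Signature}

/-- The stacks that a memory describes. -/
def Memory.st (m : Memory S T) : Stacks (Alphabet S T)
  | .inp => m.inp
  | .rest => m.rest
  | .out => m.out
  | .acc => m.acc
  | .wt b => m.wt b
  | .bits => m.bits
  | .ctr c => List.replicate (m.ctr c) ()
  | .tick => List.replicate m.tick ()

theorem Memory.update_eq {m m' : Memory S T} {k : Store} {l : List (Alphabet S T k)}
    (h₁ : m'.st k = l) (h₂ : ∀ k', k' ≠ k → m'.st k' = m.st k') : update m.st k l = m'.st := by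
  funext k'
  rcases eq_or_ne k' k with rfl | h
  · rw [update_self, h₁]
  · rw [update_of_ne h, h₂ k' h]

theorem Memory.update_inp (m : Memory S T) (l : List (Letter T)) :
    update m.st .inp l = { m with inp := l }.st :=
  Memory.update_eq rfl fun k hk => by cases k <;> first | rfl | exact absurd rfl hk

theorem Memory.update_rest (m : Memory S T) (l : List (Letter T)) :
    update m.st .rest l = { m with rest := l }.st :=
  Memory.update_eq rfl fun k hk => by cases k <;> first | rfl | exact absurd rfl hk

theorem Memory.update_out (m : Memory S T) (l : List (Letter S)) :
    update m.st .out l = { m with out := l }.st :=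
  Memory.update_eq rfl fun k hk => by cases k <;> first | rfl | exact absurd rfl hk

theorem Memory.update_acc (m : Memory S T) (l : List (Letter S)) :
    update m.st .acc l = { m with acc := l }.st :=
  Memory.update_eq rfl fun k hk => by cases k <;> first | rfl | exact absurd rfl hk

theorem Memory.update_bits (m : Memory S T) (l : List Bool) :
    update m.st .bits l = { m with bits := l }.st :=
  Memory.update_eq rfl fun k hk => by cases k <;> first | rfl | exact absurd rfl hk

theorem Memory.update_tick (m : Memory S T) (n : ℕ) :
    update m.st .tick (List.replicate n ()) = { m with tick := n }.st :=
  Memory.update_eq rfl fun k hk => by cases k <;> first | rfl | exact absurd rfl hk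

theorem Memory.update_wt (m : Memory S T) (b : Bool) (l : List Bool) :
    update m.st (.wt b) l = { m with wt := update m.wt b l }.st :=
  Memory.update_eq (by exact update_self b l m.wt) fun k hk => by
    cases k with
    | wt b' => exact update_of_ne (β := fun _ => List Bool) (fun h => hk (by rw [h])) l m.wt
    | _ => rfl

theorem Memory.update_ctr (m : Memory S T) (c : Counter) (n : ℕ) :
    update m.st (.ctr c) (List.replicate n ()) = { m with ctr := update m.ctr c n }.st :=
  Memory.update_eq (congrArg (List.replicate · ()) (update_self c n m.ctr)) fun k hk => by
    cases k with
    | ctr c' =>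
      exact congrArg (List.replicate · ()) (update_of_ne (fun h => hk (by rw [h])) n m.ctr)
    | _ => rfl

theorem Memory.st_ctr_succ {m : Memory S T} {c : Counter} {n : ℕ} (h : m.ctr c = n + 1) :
    m.st (.ctr c) = () :: List.replicate n () :=
  (congrArg (List.replicate · ()) h).trans List.replicate_succ

theorem Memory.st_ctr_zero {m : Memory S T} {c : Counter} (h : m.ctr c = 0) :
    m.st (.ctr c) = [] :=
  congrArg (List.replicate · ()) h

theorem Memory.st_tick_succ {m : Memory S T} {n : ℕ} (h : m.tick = n + 1) :
    m.st .tick = () :: List.replicate n () :=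
  (congrArg (List.replicate · ()) h).trans List.replicate_succ

theorem Memory.st_tick_zero {m : Memory S T} (h : m.tick = 0) : m.st .tick = [] :=
  congrArg (List.replicate · ()) h

theorem runsIn_push_of_eq {m m' : Memory S T} {k : Store} {a : Alphabet S T k}
    (h : update m.st k (a :: m.st k) = m'.st) : RunsIn (push k a) m.st m'.st 1 :=
  h ▸ runsIn_push k a m.st

theorem runsIn_push_inp (m : Memory S T) (a : Letter T) :
    RunsIn (push (Γ := Alphabet S T) .inp a) m.st { m with inp := a :: m.inp }.st 1 :=
  runsIn_push_of_eq (m.update_inp _)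

theorem runsIn_push_rest (m : Memory S T) (a : Letter T) :
    RunsIn (push (Γ := Alphabet S T) .rest a) m.st { m with rest := a :: m.rest }.st 1 :=
  runsIn_push_of_eq (m.update_rest _)

theorem runsIn_push_out (m : Memory S T) (a : Letter S) :
    RunsIn (push (Γ := Alphabet S T) .out a) m.st { m with out := a :: m.out }.st 1 :=
  runsIn_push_of_eq (m.update_out _)

theorem runsIn_push_acc (m : Memory S T) (a : Letter S) :
    RunsIn (push (Γ := Alphabet S T) .acc a) m.st { m with acc := a :: m.acc }.st 1 :=
  runsIn_push_of_eq (m.update_acc _)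

theorem runsIn_push_bits (m : Memory S T) (a : Bool) :
    RunsIn (push (Γ := Alphabet S T) .bits a) m.st { m with bits := a :: m.bits }.st 1 :=
  runsIn_push_of_eq (m.update_bits _)

theorem runsIn_push_wt (m : Memory S T) (b a : Bool) :
    RunsIn (push (Γ := Alphabet S T) (.wt b) a) m.st
      { m with wt := update m.wt b (a :: m.wt b) }.st 1 :=
  runsIn_push_of_eq (m.update_wt b _)

theorem runsIn_push_tick (m : Memory S T) :
    RunsIn (push (Γ := Alphabet S T) .tick ()) m.st { m with tick := m.tick + 1 }.st 1 :=
  runsIn_push_of_eq (m.update_tick (m.tick + 1))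

theorem runsIn_push_ctr (m : Memory S T) (c : Counter) :
    RunsIn (push (Γ := Alphabet S T) (.ctr c) ()) m.st
      { m with ctr := update m.ctr c (m.ctr c + 1) }.st 1 :=
  runsIn_push_of_eq (m.update_ctr c (m.ctr c + 1))

theorem runsIn_congr {P : Prog (Alphabet S T)} {m m₁ m₂ : Memory S T} {b b' : ℕ}
    (h : RunsIn P m.st m₁.st b) (hm : m₁ = m₂) (hb : b ≤ b') : RunsIn P m.st m₂.st b' :=
  hm ▸ h.mono hb

/-! ### Writing to the output -/

/-- `Emits P m w b`: in at most `b` steps the program `P` appends the word `w` to the output and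
leaves the rest of the memory as described by `m`. -/
def Emits (P : Prog (Alphabet S T)) (m : Memory S T) (w : List (Letter S)) (b : ℕ) : Prop :=
  ∀ u, RunsIn P { m with acc := u }.st { m with acc := w.reverse ++ u }.st b

theorem Emits.mono {P : Prog (Alphabet S T)} {m : Memory S T} {w : List (Letter S)} {b b' : ℕ}
    (h : Emits P m w b) (hb : b ≤ b') : Emits P m w b' :=
  fun u => (h u).mono hb

theorem Emits.seq {P R : Prog (Alphabet S T)} {m : Memory S T} {w w' : List (Letter S)}
    {b b' : ℕ} (h : Emits P m w b) (h' : Emits R m w' b') :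
    Emits (seq P R) m (w ++ w') (b + b') := by
  intro u
  have := (h u).seq (h' _)
  rwa [← List.append_assoc, ← List.reverse_append] at this

theorem emits_skip (m : Memory S T) : Emits skip m [] 1 :=
  fun _ => runsIn_skip _

/-- Append a fixed word to the output. -/
def emitWord (w : List (Letter S)) : Prog (Alphabet S T) :=
  seqList (w.map fun a => push (Γ := Alphabet S T) .acc a)

theorem emits_emitWord (m : Memory S T) (w : List (Letter S)) :
    Emits (emitWord w) m w (w.length + 1) := by
  induction w with
  | nil => exact emits_skip m
  | cons a w ih =>
    have h : Emits (push (Γ := Alphabet S T) .acc a) m [a] 1 := fun u =>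
      runsIn_push_acc { m with acc := u } a
    exact (h.seq ih).mono (by simp; omega)

/-- Append the letter `a` to the output, `n` times for every unit of the counter `c`, which is
preserved. -/
def emitRep (c : Counter) (n : ℕ) (a : Letter S) : Prog (Alphabet S T) :=
  seq (readWhile (Γ := Alphabet S T) (.ctr c) fun _ =>
      some (seq (push .tick ()) (emitWord (List.replicate n a))))
    (readWhile (Γ := Alphabet S T) .tick fun _ => some (push (.ctr c) ()))

theorem runsIn_emitRep_aux (c : Counter) (n : ℕ) (a : Letter S) (j : ℕ) (m : Memory S T)
    (h : m.ctr c = j) :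
    RunsIn (readWhile (Γ := Alphabet S T) (.ctr c) fun _ =>
      some (seq (push .tick ()) (emitWord (List.replicate n a)))) m.st
      { m with ctr := update m.ctr c 0, tick := m.tick + j,
               acc := (List.replicate (n * j) a).reverse ++ m.acc }.st ((n + 3) * j + 2) := by
  induction j generalizing m with
  | zero =>
    refine runsIn_congr (runsIn_readWhile_nil (Memory.st_ctr_zero h)) ?_ (by simp)
    ext1 <;> simp [h]
  | succ j ih =>
    have h1 := (runsIn_push_tick { m with ctr := update m.ctr c j }).seq
      (emits_emitWord { m with ctr := update m.ctr c j, tick := m.tick + 1 }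
        (List.replicate n a) m.acc)
    have h2 := ih { m with ctr := update m.ctr c j, tick := m.tick + 1,
                           acc := (List.replicate n a).reverse ++ m.acc } (update_self _ _ _)
    have h3 := RunsIn.readWhile_cons (Memory.st_ctr_succ h) (m.update_ctr c j) h1 h2 rfl
    refine runsIn_congr h3 ?_ ?_
    · ext1 <;> simp only [update_idem]
      · rw [← List.append_assoc, ← List.reverse_append, List.replicate_append_replicate]
        congr 3
        ring
      · ring
    · simp
      ring_nf
      omega

theorem runsIn_restore_ctr (c : Counter) (j : ℕ) (m : Memory S T) (h : m.tick = j) :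
    RunsIn (readWhile (Γ := Alphabet S T) .tick fun _ => some (push (.ctr c) ())) m.st
      { m with ctr := update m.ctr c (m.ctr c + j), tick := 0 }.st (2 * j + 2) := by
  induction j generalizing m with
  | zero =>
    refine runsIn_congr (runsIn_readWhile_nil (Memory.st_tick_zero h)) ?_ (by simp)
    ext1 <;> simp [h]
  | succ j ih =>
    have h1 := runsIn_push_ctr { m with tick := j } c
    have h2 := ih { m with tick := j, ctr := update m.ctr c (m.ctr c + 1) } rfl
    have h3 := RunsIn.readWhile_cons (Memory.st_tick_succ h) (m.update_tick j) h1 h2 rfl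
    refine runsIn_congr h3 ?_ ?_
    · ext1 <;> simp only [update_idem, update_self]
      congr 1
      ring
    · omega

theorem emits_emitRep (c : Counter) (n : ℕ) (a : Letter S) (m : Memory S T) (hm : m.tick = 0) :
    Emits (emitRep c n a) m (List.replicate (n * m.ctr c) a) ((n + 5) * (m.ctr c + 1)) := by
  intro u
  have h1 := (runsIn_emitRep_aux c n a (m.ctr c) { m with acc := u } rfl).seq
    (runsIn_restore_ctr c (m.ctr c) _ (by simp [hm]))
  refine runsIn_congr h1 ?_ ?_
  · ext1 <;> simp [hm]
  · nlinarith

/-- Append one part of the current weight to the output; it is preserved. -/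
def emitBits (b : Bool) : Prog (Alphabet S T) :=
  seq (readWhile (Γ := Alphabet S T) (.wt b) fun a => some (push .bits a))
    (readWhile (Γ := Alphabet S T) .bits fun a =>
      some (seq (push (.wt b) a) (push .acc (Letter.bit a))))

theorem runsIn_emitBits_aux (b : Bool) (l : List Bool) (m : Memory S T) (h : m.wt b = l) :
    RunsIn (readWhile (Γ := Alphabet S T) (.wt b) fun a => some (push .bits a)) m.st
      { m with wt := update m.wt b [], bits := l.reverse ++ m.bits }.st (2 * l.length + 2) := by
  induction l generalizing m with
  | nil =>
    refine runsIn_congr (runsIn_readWhile_nil h) ?_ (by simp)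
    ext1 <;> simp [h]
  | cons a l ih =>
    have h1 := runsIn_push_bits { m with wt := update m.wt b l } a
    have h2 := ih { m with wt := update m.wt b l, bits := a :: m.bits } (update_self _ _ _)
    have h3 := RunsIn.readWhile_cons (k := .wt b) (a := a) (l := l) h (m.update_wt b l) h1 h2 rfl
    refine runsIn_congr h3 ?_ ?_
    · ext1 <;> simp
    · simp; omega

theorem runsIn_restore_wt (b : Bool) (l : List Bool) (m : Memory S T) (h : m.bits = l) :
    RunsIn (readWhile (Γ := Alphabet S T) .bits fun a =>
      some (seq (push (.wt b) a) (push .acc (Letter.bit a)))) m.st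
      { m with wt := update m.wt b (l.reverse ++ m.wt b), bits := [],
               acc := (l.map Letter.bit).reverse ++ m.acc }.st (3 * l.length + 2) := by
  induction l generalizing m with
  | nil =>
    refine runsIn_congr (runsIn_readWhile_nil h) ?_ (by simp)
    ext1 <;> simp [h]
  | cons a l ih =>
    have h1 := (runsIn_push_wt { m with bits := l } b a).seq (runsIn_push_acc _ (Letter.bit a))
    have h2 := ih { m with bits := l, wt := update m.wt b (a :: m.wt b),
                           acc := Letter.bit a :: m.acc } rfl
    have h3 := RunsIn.readWhile_cons (k := .bits) (a := a) (l := l) h (m.update_bits l) h1 h2 rfl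
    refine runsIn_congr h3 ?_ ?_
    · ext1 <;> simp
    · simp; omega

theorem emits_emitBits (b : Bool) (m : Memory S T) (hm : m.bits = []) :
    Emits (emitBits b) m ((m.wt b).reverse.map Letter.bit) (5 * (m.wt b).length + 4) := by
  intro u
  have h1 := (runsIn_emitBits_aux b (m.wt b) { m with acc := u } rfl).seq
    (runsIn_restore_wt b (m.wt b).reverse _ (by simp [hm]))
  refine runsIn_congr h1 ?_ ?_
  · ext1 <;> simp [hm]
  · simp; omega

end Memory

end ValuedPCSP

/-! ### Writing constraints -/

namespace ValuedPCSP

open Function StackProgram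

section EmitsLin

variable {S T : Signature}

/-- All counters and weights in the memory have size at most `L`. -/
def Memory.Small (m : Memory S T) (L : ℕ) : Prop :=
  (∀ c, m.ctr c ≤ L) ∧ ∀ b, (m.wt b).length ≤ L

/-- The program `P` appends the word `w m` to the output, in time linear in the size of the
counters and weights. -/
def EmitsLin (P : Prog (Alphabet S T)) (w : Memory S T → List (Letter S)) : Prop :=
  ∃ C : ℕ, ∀ (m : Memory S T) (L : ℕ), m.bits = [] → m.tick = 0 → m.Small L →
    Emits P m (w m) (C * (L + 1))

theorem EmitsLin.seq {P R : Prog (Alphabet S T)} {w w' : Memory S T → List (Letter S)}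
    (h : EmitsLin P w) (h' : EmitsLin R w') : EmitsLin (seq P R) fun m => w m ++ w' m := by
  obtain ⟨C, h⟩ := h
  obtain ⟨C', h'⟩ := h'
  exact ⟨C + C', fun m L h1 h2 h3 =>
    ((h m L h1 h2 h3).seq (h' m L h1 h2 h3)).mono (add_mul _ _ _).ge⟩

theorem emitsLin_emitWord (w : List (Letter S)) :
    EmitsLin (emitWord w : Prog (Alphabet S T)) fun _ => w :=
  ⟨w.length + 1, fun m _ _ _ _ => (emits_emitWord m w).mono
    (Nat.le_mul_of_pos_right _ (Nat.succ_pos _))⟩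

theorem emitsLin_seqList {ι : Type} (l : List ι) (P : ι → Prog (Alphabet S T))
    (w : ι → Memory S T → List (Letter S)) (h : ∀ i ∈ l, EmitsLin (P i) (w i)) :
    EmitsLin (seqList (l.map P)) fun m => l.flatMap fun i => w i m := by
  induction l with
  | nil => exact emitsLin_emitWord []
  | cons i l ih =>
    exact (h i List.mem_cons_self).seq (ih fun j hj => h j (List.mem_cons_of_mem _ hj))

theorem emitsLin_emitRep (c : Counter) (n : ℕ) (a : Letter S) :
    EmitsLin (emitRep c n a : Prog (Alphabet S T)) fun m => List.replicate (n * m.ctr c) a :=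
  ⟨n + 5, fun m _ _ h h' => (emits_emitRep c n a m h).mono
    (Nat.mul_le_mul_left _ (Nat.add_le_add_right (h'.1 c) 1))⟩

theorem emitsLin_emitBits (b : Bool) :
    EmitsLin (emitBits b : Prog (Alphabet S T)) fun m => (m.wt b).reverse.map Letter.bit :=
  ⟨5, fun m L h _ h' => (emits_emitBits b m h).mono (by have := h'.2 b; omega)⟩

end EmitsLin

section Patterns

variable {S T : Signature} {A : ValuedStructure S} {D E : Type} [Finite D] [Finite E]

/-- The position, in the list of variables of sort `t`, of a variable in the blocks of the current
input variables. -/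
noncomputable def varPos (ctr : Counter → ℕ) (t : S.Srt) : PairVars A.Dom D E t → ℕ
  | .inl a => Nat.card (Pow A.Dom D t) * ctr (.pos .left) + Finite.equivFin (Pow A.Dom D t) a
  | .inr b => Nat.card (Pow A.Dom D t) * ctr (.total .left) +
      (Nat.card (Pow A.Dom E t) * ctr (.pos .right) + Finite.equivFin (Pow A.Dom E t) b)

/-- Append the position of a variable to the output. -/
noncomputable def emitVar (t : S.Srt) : PairVars A.Dom D E t → Prog (Alphabet S T)
  | .inl a => seq (emitRep (.pos .left) (Nat.card (Pow A.Dom D t)) .tick)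
      (emitWord (List.replicate (Finite.equivFin (Pow A.Dom D t) a) .tick ++ [.sep]))
  | .inr b => seq (emitRep (.total .left) (Nat.card (Pow A.Dom D t)) .tick)
      (seq (emitRep (.pos .right) (Nat.card (Pow A.Dom E t)) .tick)
        (emitWord (List.replicate (Finite.equivFin (Pow A.Dom E t) b) .tick ++ [.sep])))

theorem emitsLin_emitVar (t : S.Srt) (v : PairVars A.Dom D E t) :
    EmitsLin (emitVar t v : Prog (Alphabet S T)) fun m =>
      List.replicate (varPos m.ctr t v) .tick ++ [.sep] := by
  cases v with
  | inl a =>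
    have := (emitsLin_emitRep (S := S) (T := T) (.pos .left) (Nat.card (Pow A.Dom D t)) .tick).seq
      (emitsLin_emitWord (List.replicate (Finite.equivFin (Pow A.Dom D t) a) .tick ++ [.sep]))
    simpa only [varPos, emitVar, List.replicate_add, List.append_assoc] using this
  | inr b =>
    have := (emitsLin_emitRep (S := S) (T := T) (.total .left) (Nat.card (Pow A.Dom D t)) .tick).seq
      ((emitsLin_emitRep (.pos .right) (Nat.card (Pow A.Dom E t)) .tick).seq
      (emitsLin_emitWord (List.replicate (Finite.equivFin (Pow A.Dom E t) b) .tick ++ [.sep])))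
    simpa only [varPos, emitVar, List.replicate_add, List.append_assoc] using this

/-- The word that represents the weight of a pattern. The weight zero has the numerator zero,
represented by the empty word, and the denominator one. -/
def weightWord (weighted : Bool) (wt : Bool → List Bool) : List (Letter S) :=
  if weighted then (wt true).reverse.map .bit ++ .sep :: ((wt false).reverse.map .bit ++ [.sep])
  else [.sep, .bit true, .sep]

/-- The word that represents the constraint obtained from a pattern. -/
noncomputable def patternWord (ctr : Counter → ℕ) (wt : Bool → List Bool)
    (p : Pattern S (PairVars A.Dom D E)) : List (Letter S) :=
  .sym p.sym :: (weightWord p.weighted wt ++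
    (enum (S.Ar p.sym)).flatMap fun z => List.replicate (varPos ctr _ (p.args z)) .tick ++ [.sep])

/-- Append the constraint obtained from a pattern to the output. -/
noncomputable def emitPattern (p : Pattern S (PairVars A.Dom D E)) : Prog (Alphabet S T) :=
  seq (emitWord [.sym p.sym])
    (seq (if p.weighted then
        seq (emitBits true) (seq (emitWord [.sep]) (seq (emitBits false) (emitWord [.sep])))
      else emitWord [.sep, .bit true, .sep])
    (seqList ((enum (S.Ar p.sym)).map fun z => emitVar _ (p.args z))))

theorem emitsLin_emitPattern (p : Pattern S (PairVars A.Dom D E)) :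
    EmitsLin (emitPattern p : Prog (Alphabet S T)) fun m => patternWord m.ctr m.wt p := by
  have hw : EmitsLin (if p.weighted then
        seq (emitBits true) (seq (emitWord [.sep]) (seq (emitBits false) (emitWord [.sep])))
      else emitWord [.sep, .bit true, .sep] : Prog (Alphabet S T)) fun m =>
      weightWord p.weighted m.wt := by
    cases p.weighted with
    | true =>
      simp only [weightWord, if_true]
      exact (emitsLin_emitBits true).seq
        ((emitsLin_emitWord [.sep]).seq ((emitsLin_emitBits false).seq (emitsLin_emitWord [.sep])))
    | false =>
      simp only [weightWord, Bool.false_eq_true, if_false]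
      exact emitsLin_emitWord _
  exact (emitsLin_emitWord [.sym p.sym]).seq
    (hw.seq (emitsLin_seqList _ _ _ fun z _ => emitsLin_emitVar _ (p.args z)))

/-- Append the constraints obtained from a list of patterns to the output. -/
noncomputable def emitPatterns (l : List (Pattern S (PairVars A.Dom D E))) : Prog (Alphabet S T) :=
  seqList (l.map emitPattern)

/-- The word that represents a list of patterns. -/
noncomputable def patternsWord (ctr : Counter → ℕ) (wt : Bool → List Bool)
    (l : List (Pattern S (PairVars A.Dom D E))) : List (Letter S) :=
  l.flatMap (patternWord ctr wt)

theorem emitsLin_emitPatterns (l : List (Pattern S (PairVars A.Dom D E))) :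
    EmitsLin (emitPatterns l : Prog (Alphabet S T)) fun m => patternsWord m.ctr m.wt l :=
  emitsLin_seqList l _ _ fun p _ => emitsLin_emitPattern p

/-- Append, for each variable on the side `z`, the constraints obtained from a list of patterns to
the output. The units of the counter `total z` are moved to the counter `pos z` one by one, and
finally back. -/
noncomputable def emitBlocks (z : Side) (l : List (Pattern S (PairVars A.Dom D E))) :
    Prog (Alphabet S T) :=
  seq (readWhile (Γ := Alphabet S T) (.ctr (.total z)) fun _ =>
      some (seq (emitPatterns l) (push (.ctr (.pos z)) ())))
    (readWhile (Γ := Alphabet S T) (.ctr (.pos z)) fun _ => some (push (.ctr (.total z)) ()))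

/-- The first loop of `emitBlocks`. The word that the patterns become is assumed to depend only on
the counter `pos z`, through `g`, as the loop changes the counter `total z`. -/
theorem runsIn_emitBlocks_aux (z : Side) (l : List (Pattern S (PairVars A.Dom D E))) {C L : ℕ}
    (hC : ∀ (m : Memory S T) (L : ℕ), m.bits = [] → m.tick = 0 → m.Small L →
      Emits (emitPatterns l) m (patternsWord m.ctr m.wt l) (C * (L + 1)))
    (g : ℕ → List (Letter S)) (j : ℕ) (m : Memory S T)
    (hg : ∀ (ctr : Counter → ℕ), (∀ c, c ≠ .total z → c ≠ .pos z → ctr c = m.ctr c) →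
      patternsWord ctr m.wt l = g (ctr (.pos z)))
    (hb : m.bits = []) (ht : m.tick = 0) (hs : m.Small L) (hj : m.ctr (.total z) = j)
    (hL : m.ctr (.pos z) + j ≤ L) :
    RunsIn (readWhile (Γ := Alphabet S T) (.ctr (.total z)) fun _ =>
      some (seq (emitPatterns l) (push (.ctr (.pos z)) ()))) m.st
      { m with ctr := update (update m.ctr (.total z) 0) (.pos z) (m.ctr (.pos z) + j)
               acc := ((List.range' (m.ctr (.pos z)) j).flatMap g).reverse ++ m.acc }.st
      (j * (C * (L + 1) + 2) + 2) := by
  induction j generalizing m with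
  | zero =>
    refine runsIn_congr (runsIn_readWhile_nil (Memory.st_ctr_zero hj)) ?_ (by simp)
    have : update (update m.ctr (.total z) 0) (.pos z) (m.ctr (.pos z)) = m.ctr := by
      rw [← hj, update_eq_self, update_eq_self]
    ext1 <;> simp [this]
  | succ j ih =>
    have hne : Counter.pos z ≠ Counter.total z := by simp
    have hs' : Memory.Small { m with ctr := update m.ctr (.total z) j } L := by
      refine ⟨fun c => ?_, hs.2⟩
      by_cases h : c = .total z
      · subst h
        simp only [update_self]
        omega
      · simp only [update_of_ne h]
        exact hs.1 c
    have h1 := (hC { m with ctr := update m.ctr (.total z) j } L hb ht hs' m.acc).seq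
      (runsIn_push_ctr _ (.pos z))
    have hw : patternsWord (update m.ctr (.total z) j) m.wt l = g (m.ctr (.pos z)) := by
      rw [hg _ fun c h _ => update_of_ne h _ _, update_of_ne hne]
    have h2 := ih
      { m with ctr := update (update m.ctr (.total z) j) (.pos z) (m.ctr (.pos z) + 1)
               acc := (g (m.ctr (.pos z))).reverse ++ m.acc }
      (fun ctr h => hg ctr fun c hc hc' => by
        rw [h c hc hc']
        simp [hc, hc']) hb ht ?_ ?_ ?_
    · simp only [hw, update_of_ne hne] at h1
      have h3 := RunsIn.readWhile_cons (Memory.st_ctr_succ hj) (m.update_ctr _ j) h1 h2 rfl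
      refine runsIn_congr h3 ?_ ?_
      · ext1 <;> simp only [update_self]
        · simp [List.range'_succ]
        · rw [update_comm hne, update_idem, update_idem]
          congr 1
          omega
      · ring_nf
        omega
    · refine ⟨fun c => ?_, hs.2⟩
      by_cases h : c = .pos z
      · subst h
        simp only [update_self]
        omega
      · simp only [update_of_ne h]
        exact hs'.1 c
    · simp only
      rw [update_of_ne hne.symm, update_self]
    · simp only [update_self]
      omega

theorem runsIn_restore_total (z : Side) (j : ℕ) (m : Memory S T) (h : m.ctr (.pos z) = j) :
    RunsIn (readWhile (Γ := Alphabet S T) (.ctr (.pos z)) fun _ =>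
      some (push (.ctr (.total z)) ())) m.st
      { m with ctr := update (update m.ctr (.total z) (m.ctr (.total z) + j)) (.pos z) 0 }.st
      (2 * j + 2) := by
  have hne : Counter.total z ≠ Counter.pos z := by simp
  induction j generalizing m with
  | zero =>
    refine runsIn_congr (runsIn_readWhile_nil (Memory.st_ctr_zero h)) ?_ (by simp)
    ext1 <;> simp [h]
  | succ j ih =>
    have h1 := runsIn_push_ctr { m with ctr := update m.ctr (.pos z) j } (.total z)
    have h2 := ih
      { m with ctr := update (update m.ctr (.pos z) j) (.total z) (m.ctr (.total z) + 1) } (by simp)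
    simp only [update_of_ne hne] at h1
    have h3 := RunsIn.readWhile_cons (Memory.st_ctr_succ h) (m.update_ctr _ j) h1 h2 rfl
    refine runsIn_congr h3 ?_ ?_
    · ext1 <;> simp only [update_self, update_idem]
      rw [update_comm hne.symm, update_idem, add_right_comm, add_assoc]
    · omega

theorem exists_emits_emitBlocks (z : Side) (l : List (Pattern S (PairVars A.Dom D E))) :
    ∃ C : ℕ, ∀ (m : Memory S T) (L : ℕ) (g : ℕ → List (Letter S)),
      (∀ (ctr : Counter → ℕ), (∀ c, c ≠ .total z → c ≠ .pos z → ctr c = m.ctr c) →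
        patternsWord ctr m.wt l = g (ctr (.pos z))) →
      m.bits = [] → m.tick = 0 → m.Small L → m.ctr (.pos z) = 0 →
      Emits (emitBlocks z l) m ((List.range (m.ctr (.total z))).flatMap g)
        (C * (L + 1) ^ 2) := by
  obtain ⟨C, hC⟩ := emitsLin_emitPatterns (T := T) l
  refine ⟨C + 8, fun m L g hg hb ht hs hp u => ?_⟩
  have hL := hs.1 (.total z)
  have h1 := runsIn_emitBlocks_aux z l (L := L) hC g (m.ctr (.total z)) { m with acc := u } hg hb
    ht hs rfl (by simpa [hp] using hL)
  have h2 := runsIn_restore_total z (m.ctr (.total z))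
    { m with ctr := update (update m.ctr (.total z) 0) (.pos z) (m.ctr (.pos z) + m.ctr (.total z))
             acc := ((List.range' (m.ctr (.pos z)) (m.ctr (.total z))).flatMap g).reverse ++ u }
    (by simp [hp])
  refine runsIn_congr (h1.seq h2) ?_ ?_
  · have hne : Counter.total z ≠ Counter.pos z := by simp
    ext1 <;> simp only [hp, List.range_eq_range']
    funext c
    by_cases h : c = .pos z
    · subst h
      simp [hp]
    · by_cases h' : c = .total z
      · subst h'
        simp
      · simp [h, h']
  · generalize m.ctr (.total z) = j at hL
    nlinarith [Nat.mul_le_mul_right (C * (L + 1) + 4) hL]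

end Patterns

end ValuedPCSP

/-! ### The word of the reduced instance -/

namespace ValuedPCSP

open Function StackProgram

section Words

variable {S : Signature} {A : ValuedStructure S} {D E : Type} [Finite D] [Finite E]

/-- The numbering of the variables of the reduced instance. -/
noncomputable def blockEquiv (A : ValuedStructure S) (D E : Type) [Finite D] [Finite E]
    (n : Side → ℕ) (t : S.Srt) :
    BlockVars A D E n t ≃
      Fin (n .left * Nat.card (Pow A.Dom D t) + n .right * Nat.card (Pow A.Dom E t)) :=
  (Equiv.sumCongr
    (((Equiv.refl _).prodCongr (Finite.equivFin (Pow A.Dom D t))).trans finProdFinEquiv)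
    (((Equiv.refl _).prodCongr (Finite.equivFin (Pow A.Dom E t))).trans finProdFinEquiv)).trans
    finSumFinEquiv

/-- The instance to which an instance of Gap Label Cover is reduced. -/
noncomputable def reducedInstance (pat : (D → E) → List (Pattern S (PairVars A.Dom D E)))
    (I : Instance (glcSignature D E)) : Instance S where
  numVars t := I.numVars .left * Nat.card (Pow A.Dom D t) +
    I.numVars .right * Nat.card (Pow A.Dom E t)
  formula := (blockFormula pat I).map (Constraint.map fun t => blockEquiv A D E I.numVars t)

theorem exists_atLeast_reducedInstance_iff {B : ValuedStructure S} {c : ℝ}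
    {pat : (D → E) → List (Pattern S (PairVars A.Dom D E))} {I : Instance (glcSignature D E)} :
    (∃ h, AtLeast (reducedInstance pat I).formula B h c) ↔
      ∃ h, AtLeast (blockFormula pat I) B h c := by
  constructor
  · rintro ⟨h, hh⟩
    exact ⟨_, (atLeast_map _ h).1 hh⟩
  · rintro ⟨h, hh⟩
    refine ⟨fun t v => h t ((blockEquiv A D E I.numVars t).symm v), (atLeast_map _ _).2 ?_⟩
    simpa only [Equiv.symm_apply_apply] using hh

/-- The values of the counters, given by the totals and the current positions. -/
def counters (n x : Side → ℕ) : Counter → ℕ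
  | .total z => n z
  | .pos z => x z

/-- The two parts of a weight, in the form in which they are kept in the memory. -/
def weightBits (w : ℚ≥0) : Bool → List Bool
  | true => (Computability.encodeNat w.num).reverse
  | false => (Computability.encodeNat w.den).reverse

theorem encodeNat_eq_nil {n : ℕ} : Computability.encodeNat n = [] ↔ n = 0 := by
  constructor
  · intro h
    rw [← Computability.decode_encodeNat n, h]
    rfl
  · rintro rfl
    rfl

/-- The pattern `p` represents the constraint that it becomes. -/
theorem encodeConstraint_eq_patternWord {n : Side → ℕ} {ctr : Counter → ℕ}
    {wt : Bool → List Bool} (p : Pattern S (PairVars A.Dom D E)) (w : ℚ≥0)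
    (args : Tuple S (BlockVars A D E n) p.sym)
    (hargs : ∀ z, (blockEquiv A D E n _ (args z) : ℕ) = varPos ctr _ (p.args z))
    (hwt : if p.weighted then wt = weightBits w else w = 0) :
    encodeConstraint ((⟨w, p.sym, args⟩ : Constraint S _).map fun t => blockEquiv A D E n t) =
      patternWord ctr wt p := by
  have hw : encodeNum w.num ++ Letter.sep :: (encodeNum w.den ++ [Letter.sep]) =
      weightWord (S := S) p.weighted wt := by
    cases hp : p.weighted with
    | true =>
      rw [hp, if_pos rfl] at hwt
      simp [hwt, weightWord, weightBits, encodeNum]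
    | false =>
      rw [hp, if_neg Bool.false_ne_true] at hwt
      subst hwt
      rfl
  have hz : ((enum (S.Ar p.sym)).flatMap fun z =>
      List.replicate (blockEquiv A D E n _ (args z) : ℕ) (Letter.tick (S := S)) ++ [.sep]) =
      (enum (S.Ar p.sym)).flatMap fun z =>
        List.replicate (varPos ctr _ (p.args z)) .tick ++ [.sep] := by
    simp only [hargs]
  rw [patternWord, ← hw, ← hz]
  simp only [List.append_assoc, List.cons_append, List.nil_append]
  rfl

theorem blockEquiv_leftBlock {n x : Side → ℕ} (i : Fin (n .left)) (hx : x .left = i) (t : S.Srt)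
    (a : Pow A.Dom D t) :
    (blockEquiv A D E n t (leftBlock n i t a) : ℕ) =
      varPos (E := E) (counters n x) t (.inl a) := by
  simp [blockEquiv, leftBlock, varPos, counters, finProdFinEquiv, hx, add_comm]

theorem blockEquiv_rightBlock {n x : Side → ℕ} (i : Fin (n .right)) (hx : x .right = i)
    (t : S.Srt) (b : Pow A.Dom E t) :
    (blockEquiv A D E n t (rightBlock n i t b) : ℕ) =
      varPos (D := D) (counters n x) t (.inr b) := by
  simp [blockEquiv, rightBlock, varPos, counters, finProdFinEquiv, hx, add_comm, mul_comm]

/-- Rename the variables of a pattern. -/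
def Pattern.map {X Y : S.Srt → Type} (g : SortedMap X Y) (p : Pattern S X) : Pattern S Y :=
  ⟨p.weighted, p.sym, p.args.comp g⟩

/-- The polymorphism constraints on `A^D`, with variables in `A^D ∪ A^E`. -/
noncomputable def leftPatterns (A : ValuedStructure S) (D E : Type) [Finite D] :
    List (Pattern S (PairVars A.Dom D E)) :=
  (polPatterns A D).map (Pattern.map fun _ => Sum.inl)

/-- The polymorphism constraints on `A^E`, with variables in `A^D ∪ A^E`. -/
noncomputable def rightPatterns (A : ValuedStructure S) (D E : Type) [Finite E] :
    List (Pattern S (PairVars A.Dom D E)) :=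
  (polPatterns A E).map (Pattern.map fun _ => Sum.inr)

theorem weighted_polPatterns {N : Type} [Finite N] :
    ∀ p ∈ polPatterns A N, p.weighted = false := by
  simp only [polPatterns, List.forall_mem_map, implies_true]

/-- The polymorphism constraints on the `i`-th left block. -/
noncomputable def leftWord (A : ValuedStructure S) (D E : Type) [Finite D] [Finite E] (i : ℕ) :
    List (Letter S) :=
  patternsWord (counters 0 fun _ => i) (fun _ => []) (leftPatterns A D E)

/-- The polymorphism constraints on the `i`-th right block, when there are `n` left blocks. -/
noncomputable def rightWord (A : ValuedStructure S) (D E : Type) [Finite D] [Finite E]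
    (n i : ℕ) : List (Letter S) :=
  patternsWord (counters (fun _ => n) fun _ => i) (fun _ => []) (rightPatterns A D E)

theorem patternsWord_leftPatterns (ctr : Counter → ℕ) (wt : Bool → List Bool) :
    patternsWord ctr wt (leftPatterns A D E) = leftWord A D E (ctr (.pos .left)) := by
  simp only [leftWord, patternsWord, leftPatterns, List.flatMap_map]
  refine List.flatMap_congr fun p hp => ?_
  simp only [patternWord, Pattern.map, weighted_polPatterns p hp, weightWord]
  rfl

theorem patternsWord_rightPatterns (ctr : Counter → ℕ) (wt : Bool → List Bool) :
    patternsWord ctr wt (rightPatterns A D E) =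
      rightWord A D E (ctr (.total .left)) (ctr (.pos .right)) := by
  simp only [rightWord, patternsWord, rightPatterns, List.flatMap_map]
  refine List.flatMap_congr fun p hp => ?_
  simp only [patternWord, Pattern.map, weighted_polPatterns p hp, weightWord]
  rfl

/-- The word that replaces an input constraint. -/
noncomputable def constraintWord (pat : (D → E) → List (Pattern S (PairVars A.Dom D E)))
    {n : Side → ℕ} (C : Constraint (glcSignature D E) fun t => Fin (n t)) : List (Letter S) :=
  if C.weight = 0 then [] else
    patternsWord (counters n fun z => C.args z) (weightBits C.weight) (pat C.sym)

/-- The list of the variables of the reduced instance. -/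
noncomputable def headerWord (A : ValuedStructure S) (D E : Type) (n : Side → ℕ) :
    List (Letter S) :=
  (enum S.Srt).flatMap fun t =>
    List.replicate (Nat.card (Pow A.Dom D t) * n .left) (.srt t) ++
      List.replicate (Nat.card (Pow A.Dom E t) * n .right) (.srt t)

theorem encodeInstance_reducedInstance
    (pat : (D → E) → List (Pattern S (PairVars A.Dom D E))) (I : Instance (glcSignature D E)) :
    encodeInstance (reducedInstance pat I) =
      headerWord A D E I.numVars ++
        ((List.range (I.numVars .left)).flatMap (leftWord A D E) ++
        ((List.range (I.numVars .right)).flatMap (rightWord A D E (I.numVars .left)) ++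
        I.formula.flatMap (constraintWord pat))) := by
  have range_eq : ∀ (n : ℕ) (g : ℕ → List (Letter S)),
      (List.range n).flatMap g = (List.finRange n).flatMap fun i : Fin n => g i := by
    intro n g
    rw [← List.map_coe_finRange_eq_range, List.flatMap_map]
  have hh : ((enum S.Srt).flatMap fun t =>
      List.replicate ((reducedInstance pat I).numVars t) (Letter.srt t)) =
      headerWord A D E I.numVars := by
    refine List.flatMap_congr fun t _ => ?_
    rw [← List.replicate_add, mul_comm, mul_comm (Nat.card _)]
    simp only [reducedInstance]
  rw [encodeInstance, hh, range_eq, range_eq]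
  congr 1
  simp only [reducedInstance, blockFormula, List.map_append, List.flatMap_append, List.flatMap_map,
    List.flatMap_assoc]
  congr 1
  · refine List.flatMap_congr fun i _ => ?_
    refine Eq.trans ?_ (patternsWord_leftPatterns (counters I.numVars fun _ => i) fun _ => [])
    simp only [patternsWord, leftPatterns, List.flatMap_map]
    refine List.flatMap_congr fun p hp => ?_
    refine encodeConstraint_eq_patternWord (p.map fun _ => Sum.inl) _ _
      (fun z => blockEquiv_leftBlock i rfl _ (p.args z)) ?_
    simp [Pattern.map, Pattern.weigh, weighted_polPatterns p hp]
  congr 1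
  · refine List.flatMap_congr fun i _ => ?_
    refine Eq.trans ?_ (patternsWord_rightPatterns (counters I.numVars fun _ => i) fun _ => [])
    simp only [patternsWord, rightPatterns, List.flatMap_map]
    refine List.flatMap_congr fun p hp => ?_
    refine encodeConstraint_eq_patternWord (p.map fun _ => Sum.inr) _ _
      (fun z => blockEquiv_rightBlock i rfl _ (p.args z)) ?_
    simp [Pattern.map, Pattern.weigh, weighted_polPatterns p hp]
  · refine List.flatMap_congr fun C _ => ?_
    rw [constraintWord]
    split_ifs with hC
    · rfl
    simp only [patternsWord, List.flatMap_map]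
    refine List.flatMap_congr fun p hp => ?_
    refine encodeConstraint_eq_patternWord p _ _ (fun z => ?_) ?_
    · simp only [Tuple.comp, Pattern.weigh, pairBlock, pairMap]
      cases p.args z with
      | inl a => exact blockEquiv_leftBlock _ rfl _ a
      | inr b => exact blockEquiv_rightBlock _ rfl _ b
    · cases hp : p.weighted <;> simp [Pattern.weigh, hp]

end Words

end ValuedPCSP

/-! ### Reading the input -/

namespace ValuedPCSP

open Function StackProgram

section Reading

variable {S T : Signature}

theorem update_counters_total (n x : Side → ℕ) (z : Side) (k : ℕ) :
    update (counters n x) (.total z) k = counters (update n z k) x := by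
  funext c
  cases c with
  | total z' =>
    by_cases h : z' = z
    · subst h; simp [counters]
    · simp [counters, h]
  | pos z' => simp [counters]

theorem update_counters_pos (n x : Side → ℕ) (z : Side) (k : ℕ) :
    update (counters n x) (.pos z) k = counters n (update x z k) := by
  funext c
  cases c with
  | total z' => simp [counters]
  | pos z' =>
    by_cases h : z' = z
    · subst h; simp [counters]
    · simp [counters, h]

/-- Add `x` to `f` at the elements of a list. -/
noncomputable def addOn (zs : List Side) (f x : Side → ℕ) : Side → ℕ :=
  fun z => if z ∈ zs then f z + x z else f z

theorem addOn_nil (f x : Side → ℕ) : addOn [] f x = f := by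
  funext z; simp [addOn]

theorem addOn_cons {z : Side} {zs : List Side} (hz : z ∉ zs) (f x : Side → ℕ) :
    addOn zs (update f z (f z + x z)) x = addOn (z :: zs) f x := by
  funext z'
  by_cases h : z' = z
  · subst h; simp [addOn, hz]
  · simp [addOn, h]

theorem addOn_enum (x : Side → ℕ) : addOn (enum Side) 0 x = x := by
  funext z; simp [addOn, mem_enum]

/-- Read one part of a weight, up to the separator. -/
def readBits (b : Bool) : Prog (Alphabet S T) :=
  readWhile (Γ := Alphabet S T) .inp fun a : Letter T => match a with
    | .bit x => some (push (.wt b) x)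
    | _ => none

theorem runsIn_readBits (b : Bool) (u : List Bool) (l : List (Letter T)) (m : Memory S T)
    (h : m.inp = u.map .bit ++ .sep :: l) :
    RunsIn (readBits b) m.st
      { m with inp := l, wt := update m.wt b (u.reverse ++ m.wt b) }.st (2 * u.length + 2) := by
  unfold readBits
  induction u generalizing m with
  | nil =>
    refine runsIn_congr (runsIn_readWhile_stop (k := Store.inp) (a := Letter.sep) (l := l) h
      (m.update_inp l) rfl) ?_ (by simp)
    ext1 <;> simp
  | cons x u ih =>
    have h1 := runsIn_push_wt { m with inp := u.map .bit ++ .sep :: l } b x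
    have h2 := ih { m with inp := u.map .bit ++ .sep :: l, wt := update m.wt b (x :: m.wt b) } rfl
    have h3 := RunsIn.readWhile_cons (k := .inp) (a := Letter.bit x)
      (l := u.map .bit ++ .sep :: l) h (m.update_inp _) h1 h2 rfl
    refine runsIn_congr h3 ?_ ?_
    · ext1 <;> simp
    · simp; omega

/-- Read the position of a variable on the side `z`. -/
def readTicks (z : Side) : Prog (Alphabet S T) :=
  readWhile (Γ := Alphabet S T) .inp fun a : Letter T => match a with
    | .tick => some (push (.ctr (.pos z)) ())
    | _ => none

theorem runsIn_readTicks (z : Side) (k : ℕ) (l : List (Letter T)) (n x : Side → ℕ)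
    (m : Memory S T) (h : m.inp = List.replicate k .tick ++ .sep :: l)
    (hc : m.ctr = counters n x) :
    RunsIn (readTicks z) m.st
      { m with inp := l, ctr := counters n (update x z (x z + k)) }.st (2 * k + 2) := by
  unfold readTicks
  induction k generalizing m x with
  | zero =>
    refine runsIn_congr (runsIn_readWhile_stop (k := Store.inp) (a := Letter.sep) (l := l) h
      (m.update_inp l) rfl) ?_ (by simp)
    ext1 <;> simp [hc]
  | succ k ih =>
    have h1 := runsIn_push_ctr { m with inp := List.replicate k .tick ++ .sep :: l } (.pos z)
    have h2 := ih (update x z (x z + 1))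
      { m with inp := List.replicate k .tick ++ .sep :: l
               ctr := update m.ctr (.pos z) (m.ctr (.pos z) + 1) } rfl
      (by rw [hc, update_counters_pos]; rfl)
    have h3 := RunsIn.readWhile_cons (k := .inp) (a := Letter.tick)
      (l := List.replicate k .tick ++ .sep :: l) (h.trans (by rw [List.replicate_succ]; rfl))
      (m.update_inp _) h1 h2 rfl
    refine runsIn_congr h3 ?_ (by omega)
    ext1 <;> simp [add_assoc, add_comm 1 k]

theorem runsIn_readArgs (zs : List Side) (hzs : zs.Nodup) (y : Side → ℕ) {L : ℕ}
    (hy : ∀ z, y z ≤ L) (l : List (Letter T)) (n x : Side → ℕ) (m : Memory S T)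
    (h : m.inp = (zs.flatMap fun z => List.replicate (y z) .tick ++ [.sep]) ++ l)
    (hc : m.ctr = counters n x) :
    RunsIn (seqList (zs.map readTicks)) m.st
      { m with inp := l, ctr := counters n (addOn zs x y) }.st
      (zs.length * (2 * L + 2) + 1) := by
  induction zs generalizing m x with
  | nil =>
    refine runsIn_congr (runsIn_skip m.st) ?_ (by simp)
    ext1 <;> simp [addOn_nil, hc, h]
  | cons z zs ih =>
    rw [List.nodup_cons] at hzs
    have h1 := runsIn_readTicks z (y z)
      ((zs.flatMap fun z => List.replicate (y z) .tick ++ [.sep]) ++ l) n x m (by simp [h]) hc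
    have h2 := ih hzs.2 (update x z (x z + y z))
      { m with inp := (zs.flatMap fun z => List.replicate (y z) .tick ++ [.sep]) ++ l
               ctr := counters n (update x z (x z + y z)) } rfl rfl
    refine runsIn_congr (h1.seq h2) ?_ ?_
    · rw [addOn_cons hzs.1]
    · have := hy z
      simp only [List.length_cons]
      linarith

/-- Empty a stack. -/
def clear (k : Store) : Prog (Alphabet S T) :=
  readWhile (Γ := Alphabet S T) k fun _ => some skip

theorem runsIn_clear_wt (b : Bool) (l : List Bool) (m : Memory S T) (h : m.wt b = l) :
    RunsIn (clear (.wt b)) m.st { m with wt := update m.wt b [] }.st (2 * l.length + 2) := by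
  unfold clear
  induction l generalizing m with
  | nil =>
    refine runsIn_congr (runsIn_readWhile_nil h) ?_ (by simp)
    ext1 <;> simp [← h]
  | cons a l ih =>
    have h1 := runsIn_skip { m with wt := update m.wt b l }.st
    have h2 := ih { m with wt := update m.wt b l } (update_self _ _ _)
    have h3 := RunsIn.readWhile_cons (k := .wt b) (a := a) (l := l) h (m.update_wt b l) h1 h2 rfl
    refine runsIn_congr h3 ?_ ?_
    · ext1 <;> simp
    · simp; omega

theorem runsIn_clear_ctr (c : Counter) (k : ℕ) (m : Memory S T) (h : m.ctr c = k) :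
    RunsIn (clear (.ctr c)) m.st { m with ctr := update m.ctr c 0 }.st (2 * k + 2) := by
  unfold clear
  induction k generalizing m with
  | zero =>
    refine runsIn_congr (runsIn_readWhile_nil (Memory.st_ctr_zero h)) ?_ (by simp)
    ext1 <;> simp [← h]
  | succ k ih =>
    have h1 := runsIn_skip { m with ctr := update m.ctr c k }.st
    have h2 := ih { m with ctr := update m.ctr c k } (update_self _ _ _)
    have h3 := RunsIn.readWhile_cons (Memory.st_ctr_succ h) (m.update_ctr c k) h1 h2 rfl
    refine runsIn_congr h3 ?_ (by omega)
    ext1 <;> simp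

/-- Separate the header of the input: the sorts of the variables are counted, everything else is
moved to the buffer. -/
def splitHeader {D E : Type} [Finite D] [Finite E] : Prog (Alphabet S (glcSignature D E)) :=
  readWhile (Γ := Alphabet S (glcSignature D E)) .inp fun a : Letter (glcSignature D E) =>
    match a with
    | .srt z => some (push (.ctr (.total z)) ())
    | .sym π => some (push .rest (.sym π))
    | .bit b => some (push .rest (.bit b))
    | .tick => some (push .rest .tick)
    | .sep => some (push .rest .sep)

/-- Move the buffer back to the input stack. -/
def restoreInput : Prog (Alphabet S T) :=
  readWhile (Γ := Alphabet S T) .rest fun a => some (push .inp a)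

theorem runsIn_restoreInput (l : List (Letter T)) (m : Memory S T) (h : m.rest = l) :
    RunsIn restoreInput m.st { m with rest := [], inp := l.reverse ++ m.inp }.st
      (2 * l.length + 2) := by
  unfold restoreInput
  induction l generalizing m with
  | nil =>
    refine runsIn_congr (runsIn_readWhile_nil h) ?_ (by simp)
    ext1 <;> simp [h]
  | cons a l ih =>
    have h1 := runsIn_push_inp { m with rest := l } a
    have h2 := ih { m with rest := l, inp := a :: m.inp } rfl
    have h3 := RunsIn.readWhile_cons (k := .rest) (a := a) (l := l) h (m.update_rest l) h1 h2 rfl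
    refine runsIn_congr h3 ?_ ?_
    · ext1 <;> simp
    · simp; omega

/-- Move the output from the auxiliary stack, where it is reversed, to the output stack. -/
def moveOutput : Prog (Alphabet S T) :=
  readWhile (Γ := Alphabet S T) .acc fun a => some (push .out a)

theorem runsIn_moveOutput (l : List (Letter S)) (m : Memory S T) (h : m.acc = l) :
    RunsIn moveOutput m.st { m with acc := [], out := l.reverse ++ m.out }.st
      (2 * l.length + 2) := by
  unfold moveOutput
  induction l generalizing m with
  | nil =>
    refine runsIn_congr (runsIn_readWhile_nil h) ?_ (by simp)
    ext1 <;> simp [h]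
  | cons a l ih =>
    have h1 := runsIn_push_out { m with acc := l } a
    have h2 := ih { m with acc := l, out := a :: m.out } rfl
    have h3 := RunsIn.readWhile_cons (k := .acc) (a := a) (l := l) h (m.update_acc l) h1 h2 rfl
    refine runsIn_congr h3 ?_ ?_
    · ext1 <;> simp
    · simp; omega

section Header

variable {D E : Type} [Finite D] [Finite E]

theorem runsIn_splitHeader_body (l : List (Letter (glcSignature D E)))
    (hl : ∀ z, Letter.srt z ∉ l) (m : Memory S (glcSignature D E)) (h : m.inp = l) :
    RunsIn splitHeader m.st { m with inp := [], rest := l.reverse ++ m.rest }.st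
      (2 * l.length + 2) := by
  unfold splitHeader
  induction l generalizing m with
  | nil =>
    refine runsIn_congr (runsIn_readWhile_nil h) ?_ (by simp)
    ext1 <;> simp [h]
  | cons a l ih =>
    have h1 := runsIn_push_rest { m with inp := l } a
    have h2 := ih (fun z hz => hl z (List.mem_cons_of_mem _ hz))
      { m with inp := l, rest := a :: m.rest } rfl
    have h3 := RunsIn.readWhile_cons (k := .inp) (a := a) (l := l) h (m.update_inp l) h1 h2 (by
      cases a with
      | srt z => exact absurd List.mem_cons_self (hl z)
      | _ => rfl)
    refine runsIn_congr h3 ?_ ?_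
    · ext1 <;> simp
    · simp; omega

/-- A run of equal sorts at the head of the input is consumed before the rest of the input is
read. -/
theorem runsIn_splitHeader_replicate (z : Side) (k : ℕ) (l : List (Letter (glcSignature D E)))
    (n x : Side → ℕ) (m : Memory S (glcSignature D E))
    (h : m.inp = List.replicate k (.srt z) ++ l) (hc : m.ctr = counters n x)
    {s : Stacks (Alphabet S (glcSignature D E))} {b : ℕ}
    (hl : RunsIn splitHeader
      { m with inp := l, ctr := counters (update n z (n z + k)) x }.st s b) :
    RunsIn splitHeader m.st s (b + 2 * k) := by
  unfold splitHeader at hl ⊢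
  induction k generalizing m n with
  | zero =>
    have : { m with inp := l, ctr := counters (update n z (n z + 0)) x } = m := by
      ext1 <;> simp [h, hc]
    rwa [this] at hl
  | succ k ih =>
    have h1 := runsIn_push_ctr { m with inp := List.replicate k (.srt z) ++ l } (.total z)
    have h2 := ih (update n z (n z + 1))
      { m with inp := List.replicate k (.srt z) ++ l
               ctr := update m.ctr (.total z) (m.ctr (.total z) + 1) } rfl
      (by rw [hc, update_counters_total]; rfl)
      (by simpa [add_assoc, add_comm 1 k] using hl)
    have h3 := RunsIn.readWhile_cons (k := .inp) (a := Letter.srt z)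
      (l := List.replicate k (.srt z) ++ l) (h.trans (by rw [List.replicate_succ]; rfl))
      (m.update_inp _) h1 h2 rfl
    exact h3.mono (by omega)

theorem runsIn_splitHeader (zs : List Side) (hzs : zs.Nodup) (y : Side → ℕ)
    (l : List (Letter (glcSignature D E))) (hl : ∀ z, Letter.srt z ∉ l) (n x : Side → ℕ)
    (m : Memory S (glcSignature D E))
    (h : m.inp = (zs.flatMap fun z => List.replicate (y z) (.srt z)) ++ l)
    (hc : m.ctr = counters n x) :
    RunsIn splitHeader m.st
      { m with inp := [], rest := l.reverse ++ m.rest, ctr := counters (addOn zs n y) x }.st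
      (2 * m.inp.length + 2) := by
  induction zs generalizing m n with
  | nil =>
    refine runsIn_congr (runsIn_splitHeader_body l hl m (by simpa using h)) ?_ (by simp [h])
    ext1 <;> simp [addOn_nil, hc]
  | cons z zs ih =>
    rw [List.nodup_cons] at hzs
    have h2 := ih hzs.2 (update n z (n z + y z))
      { m with inp := (zs.flatMap fun z => List.replicate (y z) (.srt z)) ++ l
               ctr := counters (update n z (n z + y z)) x } rfl rfl
    have h1 := runsIn_splitHeader_replicate z (y z) _ n x m (by rw [h]; simp) hc h2
    refine runsIn_congr h1 ?_ ?_
    · rw [addOn_cons hzs.1]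
    · simp [h]
      omega

end Header

end Reading

end ValuedPCSP

/-! ### The reduction program -/

namespace ValuedPCSP

open Function StackProgram

section Header

variable {S : Signature} {A : ValuedStructure S} {D E : Type}

/-- Write the list of the variables of the reduced instance. -/
noncomputable def emitHeader {T : Signature} (A : ValuedStructure S) (D E : Type) :
    Prog (Alphabet S T) :=
  seqList ((enum S.Srt).map fun t =>
    seq (emitRep (.total .left) (Nat.card (Pow A.Dom D t)) (.srt t))
      (emitRep (.total .right) (Nat.card (Pow A.Dom E t)) (.srt t)))

theorem emitsLin_emitHeader {T : Signature} :
    EmitsLin (emitHeader A D E : Prog (Alphabet S T)) fun m =>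
      headerWord A D E fun z => m.ctr (.total z) :=
  emitsLin_seqList _ _ _ fun _ _ => (emitsLin_emitRep _ _ _).seq (emitsLin_emitRep _ _ _)

end Header

section Program

variable {S : Signature} {A : ValuedStructure S} {D E : Type} [Finite D] [Finite E]

/-- Append the constraints obtained from a list of patterns to the output, unless the current
weight is zero, that is, unless its numerator is the empty word. The test pops one digit of the
numerator and puts it back. -/
noncomputable def emitIfPositive {T : Signature} (l : List (Pattern S (PairVars A.Dom D E))) :
    Prog (Alphabet S T) :=
  popLoop (Γ := Alphabet S T) (.wt true) (fun _ => false) fun a : Option Bool => match a with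
    | none => skip
    | some a => seq (push (.wt true) a) (emitPatterns l)

theorem exists_runsIn_emitIfPositive {T : Signature}
    (l : List (Pattern S (PairVars A.Dom D E))) :
    ∃ C : ℕ, ∀ (m : Memory S T) (L : ℕ), m.bits = [] → m.tick = 0 → m.Small L →
      RunsIn (emitIfPositive l) m.st { m with acc :=
        (if m.wt true = [] then [] else patternsWord m.ctr m.wt l).reverse ++ m.acc }.st
        (C * (L + 1) + 2) := by
  obtain ⟨C, hC⟩ := emitsLin_emitPatterns (T := T) l
  refine ⟨C, fun m L hb ht hs => ?_⟩
  unfold emitIfPositive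
  cases hw : m.wt true with
  | nil =>
    have hs : m.st (.wt true) = [] := hw
    have hu : update m.st (.wt true) (m.st (.wt true)).tail = m.st := by
      rw [hs, List.tail_nil, ← hs, update_eq_self]
    have h := RunsIn.popLoop_exit (Γ := Alphabet S T) (k := .wt true) (again := fun _ => false)
      (body := fun a : Option Bool => match a with
        | none => skip
        | some a => seq (push (.wt true) a) (emitPatterns l)) (s := m.st) rfl
      (by rw [hu, hs]; exact runsIn_skip m.st)
    refine runsIn_congr h ?_ (by omega)
    ext1 <;> simp
  | cons a u =>
    have hs' : m.st (.wt true) = a :: u := hw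
    have hu : update m.st (.wt true) (m.st (.wt true)).tail =
        { m with wt := update m.wt true u }.st := by
      rw [hs']; exact m.update_wt true u
    have h1 := (runsIn_push_wt { m with wt := update m.wt true u } true a).seq
      (hC { m with wt := update (update m.wt true u) true (a :: update m.wt true u true) } L hb ht
        (by simpa [← hw] using hs) m.acc)
    have h := RunsIn.popLoop_exit (Γ := Alphabet S T) (k := .wt true) (again := fun _ => false)
      (body := fun a : Option Bool => match a with
        | none => skip
        | some a => seq (push (.wt true) a) (emitPatterns l)) (s := m.st) rfl
      (by rw [hu, hs']; exact h1)
    have hwt : update (update m.wt true u) true (a :: update m.wt true u true) = m.wt := by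
      rw [update_self, update_idem, ← hw, update_eq_self]
    simp only [hwt] at h
    refine runsIn_congr h ?_ (by omega)
    ext1 <;> simp

/-- Read a constraint, whose symbol has already been read, and write the constraints that
replace it. -/
noncomputable def processConstraint (l : List (Pattern S (PairVars A.Dom D E))) :
    Prog (Alphabet S (glcSignature D E)) :=
  seq (readBits true) (seq (readBits false) (seq (seqList ((enum Side).map readTicks))
    (seq (emitIfPositive l) (seq (clear (.wt true)) (seq (clear (.wt false))
      (seq (clear (.ctr (.pos .left))) (clear (.ctr (.pos .right)))))))))

theorem exists_runsIn_processConstraint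
    (pat : (D → E) → List (Pattern S (PairVars A.Dom D E))) :
    ∃ K : ℕ, ∀ (m : Memory S (glcSignature D E)) (L : ℕ) (n : Side → ℕ)
      (C : Constraint (glcSignature D E) fun t => Fin (n t)) (l : List (Letter (glcSignature D E))),
      Letter.sym C.sym :: m.inp = encodeConstraint C ++ l → m.ctr = counters n 0 →
      m.wt = (fun _ => []) → m.bits = [] → m.tick = 0 → (∀ z, n z ≤ L) →
      (encodeConstraint C).length ≤ L →
      RunsIn (processConstraint (pat C.sym)) m.st
        { m with inp := l, acc := (constraintWord pat C).reverse ++ m.acc }.st (K * (L + 1)) := by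
  choose K hK using fun π => exists_runsIn_emitIfPositive (T := glcSignature D E) (pat π)
  -- The time bounds depend on the symbol `π`, of which there are finitely many.
  obtain ⟨B, hB⟩ := (Set.finite_range K).bddAbove
  refine ⟨B + 2 * (enum Side).length + 20, fun m L n C l hin hctr hwt hbits htick hn hlen => ?_⟩
  have hB' : K C.sym ≤ B := hB ⟨C.sym, rfl⟩
  have hin' : m.inp = (Computability.encodeNat C.weight.num).map .bit ++ .sep ::
      ((Computability.encodeNat C.weight.den).map .bit ++ .sep ::
        (((enum Side).flatMap fun z => List.replicate (C.args z : ℕ) .tick ++ [.sep]) ++ l)) := by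
    simp only [encodeConstraint, List.cons_append, List.append_assoc, List.cons.injEq,
      true_and] at hin
    exact hin
  have hnum : (Computability.encodeNat C.weight.num).length ≤ L := by
    simp only [encodeConstraint, encodeNum, List.length_cons, List.length_append,
      List.length_map] at hlen
    omega
  have hden : (Computability.encodeNat C.weight.den).length ≤ L := by
    simp only [encodeConstraint, encodeNum, List.length_cons, List.length_append,
      List.length_map] at hlen
    omega
  have hargs : ∀ z, (C.args z : ℕ) ≤ L := fun z => (C.args z).is_lt.le.trans (hn z)
  have h1 := runsIn_readBits true _ _ m hin'
  have h2 := runsIn_readBits false _ _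
    { m with inp := (Computability.encodeNat C.weight.den).map .bit ++ .sep ::
        (((enum Side).flatMap fun z => List.replicate (C.args z : ℕ) .tick ++ [.sep]) ++ l)
             wt := update m.wt true
              ((Computability.encodeNat C.weight.num).reverse ++ m.wt true) } rfl
  have hw : update (update m.wt true
      ((Computability.encodeNat C.weight.num).reverse ++ m.wt true)) false
      ((Computability.encodeNat C.weight.den).reverse ++ update m.wt true
      ((Computability.encodeNat C.weight.num).reverse ++ m.wt true) false) =
      weightBits C.weight := by
    funext b
    cases b <;> simp [weightBits, hwt]
  simp only [hw] at h2
  have h3 := runsIn_readArgs (enum Side) (nodup_enum Side) (fun z => (C.args z : ℕ)) hargs l n 0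
    { m with inp := ((enum Side).flatMap fun z =>
        List.replicate (C.args z : ℕ) .tick ++ [.sep]) ++ l
             wt := weightBits C.weight } rfl hctr
  simp only [addOn_enum] at h3
  have h4 := hK C.sym
    { m with inp := l, wt := weightBits C.weight
             ctr := counters n fun z => C.args z } L hbits htick ⟨fun c => ?_, fun b => ?_⟩
  rotate_left
  · cases c with
    | total z => exact hn z
    | pos z => exact hargs z
  · cases b <;> simp [weightBits, hnum, hden]
  have hword : (if weightBits C.weight true = [] then [] else
      patternsWord (counters n fun z => (C.args z : ℕ)) (weightBits C.weight) (pat C.sym)) =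
      constraintWord pat C := by
    have hiff : weightBits C.weight true = [] ↔ C.weight = 0 := by
      rw [weightBits, List.reverse_eq_nil_iff, encodeNat_eq_nil, ← not_iff_not, ← ne_eq, ← ne_eq,
        NNRat.num_ne_zero]
    rw [constraintWord]
    by_cases h0 : C.weight = 0
    · rw [if_pos (hiff.2 h0), if_pos h0]
    · rw [if_neg fun h => h0 (hiff.1 h), if_neg h0]
  simp only [hword] at h4
  have h5 := runsIn_clear_wt true _
    { m with inp := l, wt := weightBits C.weight, ctr := counters n fun z => C.args z
             acc := (constraintWord pat C).reverse ++ m.acc } rfl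
  have h6 := runsIn_clear_wt false _
    { m with inp := l, wt := update (weightBits C.weight) true []
             ctr := counters n fun z => C.args z
             acc := (constraintWord pat C).reverse ++ m.acc } rfl
  have hw' : update (update (weightBits C.weight) true []) false [] = m.wt := by
    funext b
    cases b <;> simp [hwt]
  simp only [hw'] at h6
  have h7 := runsIn_clear_ctr (.pos .left) _
    { m with inp := l, ctr := counters n fun z => C.args z
             acc := (constraintWord pat C).reverse ++ m.acc } rfl
  have h8 := runsIn_clear_ctr (.pos .right) _
    { m with inp := l, ctr := update (counters n fun z => C.args z) (.pos .left) 0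
             acc := (constraintWord pat C).reverse ++ m.acc } rfl
  have hc : update (update (counters n fun z => (C.args z : ℕ)) (.pos .left) 0) (.pos .right) 0 =
      m.ctr := by
    rw [update_counters_pos, update_counters_pos, hctr]
    congr 1
    funext z
    cases z <;> simp
  simp only [hc] at h8
  refine (h1.seq (h2.seq (h3.seq (h4.seq (h5.seq (h6.seq (h7.seq h8))))))).mono ?_
  have e1 : (weightBits C.weight true).length ≤ L := by simpa [weightBits] using hnum
  have e2 : (update (weightBits C.weight) true [] false).length ≤ L := by
    simpa [weightBits] using hden
  have e3 : counters n (fun z => (C.args z : ℕ)) (.pos .left) ≤ L := hargs _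
  have e4 : update (counters n fun z => (C.args z : ℕ)) (.pos .left) 0 (.pos .right) ≤ L := by
    simpa [counters] using hargs .right
  have e5 : K C.sym * (L + 1) ≤ B * (L + 1) := Nat.mul_le_mul_right _ hB'
  simp only
  linarith

/-- Process all constraints of the input. -/
noncomputable def processFormula (pat : (D → E) → List (Pattern S (PairVars A.Dom D E))) :
    Prog (Alphabet S (glcSignature D E)) :=
  readWhile (Γ := Alphabet S (glcSignature D E)) .inp fun a : Letter (glcSignature D E) =>
    match a with
    | .sym π => some (processConstraint (pat π))
    | _ => none

theorem runsIn_processFormula (pat : (D → E) → List (Pattern S (PairVars A.Dom D E))) {K : ℕ}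
    (hK : ∀ (m : Memory S (glcSignature D E)) (L : ℕ) (n : Side → ℕ)
      (C : Constraint (glcSignature D E) fun t => Fin (n t)) (l : List (Letter (glcSignature D E))),
      Letter.sym C.sym :: m.inp = encodeConstraint C ++ l → m.ctr = counters n 0 →
      m.wt = (fun _ => []) → m.bits = [] → m.tick = 0 → (∀ z, n z ≤ L) →
      (encodeConstraint C).length ≤ L →
      RunsIn (processConstraint (pat C.sym)) m.st
        { m with inp := l, acc := (constraintWord pat C).reverse ++ m.acc }.st (K * (L + 1)))
    {L : ℕ} {n : Side → ℕ} (hn : ∀ z, n z ≤ L)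
    (Φ : PayoffFormula (glcSignature D E) fun t => Fin (n t))
    (hΦ : ∀ C ∈ Φ, (encodeConstraint C).length ≤ L)
    (m : Memory S (glcSignature D E)) (hin : m.inp = Φ.flatMap encodeConstraint)
    (hctr : m.ctr = counters n 0) (hwt : m.wt = fun _ => []) (hbits : m.bits = [])
    (htick : m.tick = 0) :
    RunsIn (processFormula pat) m.st
      { m with inp := [], acc := (Φ.flatMap (constraintWord pat)).reverse ++ m.acc }.st
      (Φ.length * (K * (L + 1) + 1) + 2) := by
  unfold processFormula
  induction Φ generalizing m with
  | nil =>
    refine runsIn_congr (runsIn_readWhile_nil hin) ?_ (by simp)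
    ext1 <;> simp [hin]
  | cons C Φ ih =>
    obtain ⟨l, hl⟩ : ∃ l, Letter.sym C.sym :: l =
        encodeConstraint C ++ Φ.flatMap encodeConstraint :=
      ⟨_, rfl⟩
    have hin' : m.inp = Letter.sym C.sym :: l := by rw [hl, hin, List.flatMap_cons]
    have h1 := hK { m with inp := l } L n C _ hl hctr hwt hbits htick hn
      (hΦ C List.mem_cons_self)
    have h2 := ih (fun C' hC' => hΦ C' (List.mem_cons_of_mem _ hC'))
      { m with inp := Φ.flatMap encodeConstraint, acc := (constraintWord pat C).reverse ++ m.acc }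
      rfl hctr hwt hbits htick
    have h3 := RunsIn.readWhile_cons (k := .inp) (a := Letter.sym C.sym) (l := l) hin'
      (m.update_inp l) h1 h2 rfl
    refine runsIn_congr h3 ?_ ?_
    · ext1 <;> simp
    · simp only [List.length_cons]
      linarith

/-- Produce the output, in reverse order. The blocks are written between the two passes over the
input, when the header has been counted and the constraints have not been read. -/
noncomputable def writeInstance (pat : (D → E) → List (Pattern S (PairVars A.Dom D E))) :
    Prog (Alphabet S (glcSignature D E)) :=
  seq splitHeader (seq restoreInput (seq
    (seq (emitHeader A D E)
      (seq (emitBlocks .left (leftPatterns A D E)) (emitBlocks .right (rightPatterns A D E))))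
    (processFormula pat)))

/-- The program of the reduction: the output is produced in reverse order, moved to the output
stack, and the two counters that remain are emptied. -/
noncomputable def reductionProg (pat : (D → E) → List (Pattern S (PairVars A.Dom D E))) :
    Prog (Alphabet S (glcSignature D E)) :=
  seq (writeInstance pat)
    (seq moveOutput (seq (clear (.ctr (.total .left))) (clear (.ctr (.total .right)))))

/-- The memory with no contents except on the input and output stacks and in the counters. -/
def Memory.base {T : Signature} (inp : List (Letter T)) (out acc : List (Letter S))
    (ctr : Counter → ℕ) : Memory S T where
  inp := inp
  rest := []
  out := out
  acc := acc
  wt _ := []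
  bits := []
  ctr := ctr
  tick := 0

theorem numVars_le_length_encodeInstance {S : Signature} (I : Instance S) (t : S.Srt) :
    I.numVars t ≤ (encodeInstance I).length := by
  have h := (List.sublist_flatten_of_mem (List.mem_map_of_mem
    (f := fun t => List.replicate (I.numVars t) (Letter.srt (S := S) t)) (mem_enum t))).length_le
  rw [List.length_replicate, ← List.flatMap_def] at h
  rw [encodeInstance, List.length_append]
  exact h.trans (Nat.le_add_right _ _)

theorem exists_runsIn_writeInstance (pat : (D → E) → List (Pattern S (PairVars A.Dom D E))) :
    ∃ K : ℕ, ∀ I : Instance (glcSignature D E),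
      RunsIn (writeInstance pat) (Memory.base (encodeInstance I) [] [] (counters 0 0)).st
        (Memory.base [] [] (encodeInstance (reducedInstance pat I)).reverse
          (counters I.numVars 0)).st
        (K * ((encodeInstance I).length + 1) ^ 2) := by
  obtain ⟨K₁, h₁⟩ := emitsLin_emitHeader (S := S) (A := A) (D := D) (E := E)
    (T := glcSignature D E)
  obtain ⟨K₂, h₂⟩ := exists_emits_emitBlocks (T := glcSignature D E) .left (leftPatterns A D E)
  obtain ⟨K₃, h₃⟩ := exists_emits_emitBlocks (T := glcSignature D E) .right (rightPatterns A D E)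
  obtain ⟨K₄, h₄⟩ := exists_runsIn_processConstraint pat
  refine ⟨K₁ + K₂ + K₃ + K₄ + 10, fun I => ?_⟩
  set L := (encodeInstance I).length with hL
  set body := I.formula.flatMap encodeConstraint with hbody
  have hbodyL : body.length ≤ L := by
    rw [hL, encodeInstance, List.length_append, hbody]
    exact Nat.le_add_left _ _
  have hn : ∀ z, I.numVars z ≤ L := numVars_le_length_encodeInstance I
  have hC : ∀ C ∈ I.formula, (encodeConstraint C).length ≤ L := by
    intro C hC
    have h := (List.sublist_flatten_of_mem (List.mem_map_of_mem
      (f := encodeConstraint (S := glcSignature D E)) hC)).length_le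
    rw [← List.flatMap_def] at h
    exact h.trans hbodyL
  have hlen : I.formula.length ≤ L := by
    refine le_trans ?_ hbodyL
    rw [hbody]
    generalize I.formula = Φ
    induction Φ with
    | nil => simp
    | cons C Φ ih =>
      simp only [List.flatMap_cons, List.length_append, List.length_cons, encodeConstraint] at ih ⊢
      omega
  have hsrt : ∀ z, Letter.srt z ∉ body := by
    intro z
    simp [hbody, encodeConstraint, encodeNum, List.mem_replicate]
  have r1 := runsIn_splitHeader (S := S) (enum Side) (nodup_enum Side) I.numVars body hsrt 0 0
    (Memory.base (encodeInstance I) [] [] (counters 0 0)) rfl rfl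
  have r2 := runsIn_restoreInput body.reverse
    { Memory.base (S := S) [] [] [] (counters I.numVars 0) with rest := body.reverse } rfl
  have hs : (Memory.base (S := S) body [] [] (counters I.numVars 0)).Small L := by
    refine ⟨fun c => ?_, fun b => Nat.zero_le _⟩
    cases c with
    | total z => exact hn z
    | pos z => exact Nat.zero_le _
  have e1 := h₁ (Memory.base body [] [] (counters I.numVars 0)) L rfl rfl hs
  have e2 := h₂ (Memory.base body [] [] (counters I.numVars 0)) L (leftWord A D E)
    (fun ctr _ => patternsWord_leftPatterns ctr _) rfl rfl hs rfl
  have e3 := h₃ (Memory.base body [] [] (counters I.numVars 0)) L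
    (rightWord A D E (I.numVars .left)) (fun ctr hctr => by
      rw [patternsWord_rightPatterns, hctr (.total .left) (by simp) (by simp)]
      rfl) rfl rfl hs rfl
  have r3 := (e1.seq (e2.seq e3)) []
  have r4 := runsIn_processFormula pat h₄ hn I.formula hC
    { Memory.base (S := S) body [] [] (counters I.numVars 0) with acc :=
      (headerWord A D E I.numVars ++ ((List.range (I.numVars .left)).flatMap (leftWord A D E) ++
        (List.range (I.numVars .right)).flatMap
          (rightWord A D E (I.numVars .left)))).reverse ++ [] }
    rfl rfl rfl rfl rfl
  have hm1 : { Memory.base (S := S) (encodeInstance I) [] [] (counters 0 0) with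
      inp := [], rest := body.reverse ++ [], ctr := counters (addOn (enum Side) 0 I.numVars) 0 } =
      { Memory.base (S := S) [] [] [] (counters I.numVars 0) with rest := body.reverse } := by
    rw [addOn_enum, List.append_nil]
    rfl
  have hm2 : { Memory.base (S := S) (T := glcSignature D E) [] [] [] (counters I.numVars 0) with
      rest := [], inp := body.reverse.reverse ++ [] } =
      Memory.base (S := S) body [] [] (counters I.numVars 0) := by
    rw [List.reverse_reverse, List.append_nil]
    rfl
  have r12 := (runsIn_congr r1 hm1 le_rfl).seq ((runsIn_congr r2 hm2 le_rfl).seq (r3.seq r4))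
  refine runsIn_congr r12 ?_ ?_
  · rw [encodeInstance_reducedInstance]
    ext1 <;> simp [Memory.base]
  · have q1 : I.formula.length * (K₄ * (L + 1) + 1) ≤ L * (K₄ * (L + 1) + 1) :=
      Nat.mul_le_mul_right _ hlen
    have q2 : (Memory.base (S := S) (encodeInstance I) [] [] (counters 0 0)).inp.length = L := rfl
    rw [q2, List.length_reverse]
    clear_value L body
    have q3 : L * (K₄ * (L + 1) + 1) ≤ K₄ * (L + 1) ^ 2 + L := by
      nlinarith [Nat.zero_le (K₄ * (L + 1))]
    have q4 : K₁ * (L + 1) ≤ K₁ * (L + 1) ^ 2 :=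
      Nat.mul_le_mul_left _ (Nat.le_self_pow two_ne_zero _)
    have q5 : 5 * L + 6 ≤ 10 * (L + 1) ^ 2 := by nlinarith
    rw [add_mul, add_mul, add_mul, add_mul]
    omega

/-- The reduction is computed in quadratic time. -/
theorem exists_runsIn_reductionProg (pat : (D → E) → List (Pattern S (PairVars A.Dom D E))) :
    ∃ K : ℕ, ∀ I : Instance (glcSignature D E),
      RunsIn (reductionProg pat)
        (update (fun _ => []) .inp (encodeInstance I) : Stacks (Alphabet S (glcSignature D E)))
        (update (fun _ => []) .out (encodeInstance (reducedInstance pat I)))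
        (K * ((encodeInstance I).length + 1) ^ 2) := by
  obtain ⟨K, hK⟩ := exists_runsIn_writeInstance pat
  refine ⟨3 * K + 10, fun I => ?_⟩
  have hempty : (Memory.base (S := S) (T := glcSignature D E) [] [] [] (counters 0 0)).st =
      fun _ => [] := by
    funext k
    cases k with
    | ctr c => cases c <;> rfl
    | _ => rfl
  have r1 := hK I
  -- Emptying `acc` takes time linear in the length of the output, which the running time bounds.
  have hacc := r1.length_le .acc
  have r2 := runsIn_moveOutput _ (Memory.base (T := glcSignature D E) [] []
    (encodeInstance (reducedInstance pat I)).reverse (counters I.numVars 0)) rfl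
  have r3 := runsIn_clear_ctr (.total .left) _ (Memory.base (T := glcSignature D E) []
    (encodeInstance (reducedInstance pat I)) [] (counters I.numVars 0)) rfl
  have r4 := runsIn_clear_ctr (.total .right) _ (Memory.base (T := glcSignature D E) []
    (encodeInstance (reducedInstance pat I)) []
    (update (counters I.numVars 0) (.total .left) 0)) rfl
  have hm2 : { Memory.base (T := glcSignature D E) [] []
      (encodeInstance (reducedInstance pat I)).reverse (counters I.numVars 0) with
      acc := [], out := (encodeInstance (reducedInstance pat I)).reverse.reverse ++ [] } =
      Memory.base (T := glcSignature D E) [] (encodeInstance (reducedInstance pat I)) []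
        (counters I.numVars 0) := by
    rw [List.reverse_reverse, List.append_nil]
    rfl
  have hm4 : update (update (counters I.numVars 0) (.total .left) 0) (.total .right) 0 =
      counters 0 0 := by
    rw [update_counters_total, update_counters_total]
    congr 1
    funext z
    cases z <;> simp
  have hn : ∀ z, I.numVars z ≤ (encodeInstance I).length := numVars_le_length_encodeInstance I
  have r := r1.seq ((runsIn_congr r2 hm2 le_rfl).seq (r3.seq
    (runsIn_congr r4 (m₂ := Memory.base [] (encodeInstance (reducedInstance pat I)) []
      (counters 0 0)) (by rw [← hm4]; rfl) le_rfl)))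
  have hin : (update (fun _ => []) .inp (encodeInstance I) :
      Stacks (Alphabet S (glcSignature D E))) =
      (Memory.base (encodeInstance I) [] [] (counters 0 0)).st := by
    rw [← hempty]
    exact Memory.update_inp _ _
  have hout : (update (fun _ => []) .out (encodeInstance (reducedInstance pat I)) :
      Stacks (Alphabet S (glcSignature D E))) =
      (Memory.base [] (encodeInstance (reducedInstance pat I)) [] (counters 0 0)).st := by
    rw [← hempty]
    exact Memory.update_out _ _
  rw [hin, hout]
  refine r.mono ?_
  have q1 : (encodeInstance (reducedInstance pat I)).reverse.length ≤
      0 + K * ((encodeInstance I).length + 1) ^ 2 := hacc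
  have q2 : counters I.numVars 0 (.total .left) ≤ (encodeInstance I).length := hn _
  have q3 : update (counters I.numVars 0) (.total .left) 0 (.total .right) ≤
      (encodeInstance I).length := by
    rw [update_counters_total]
    simpa [counters] using hn .right
  have q5 : (encodeInstance I).length ≤ ((encodeInstance I).length + 1) ^ 2 :=
    (Nat.le_succ _).trans (Nat.le_self_pow two_ne_zero _)
  have q6 : 1 ≤ ((encodeInstance I).length + 1) ^ 2 := Nat.one_le_pow _ _ (Nat.succ_pos _)
  have key : ∀ x y z w Q V : ℕ, V = K * Q → x ≤ 0 + V → y ≤ w → z ≤ w → w ≤ Q → 1 ≤ Q →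
      V + (2 * x + 2 + (2 * y + 2 + (2 * z + 2))) ≤ (3 * K + 10) * Q := by
    intro x y z w Q V hV
    have : (3 * K + 10) * Q = 3 * V + 10 * Q := by rw [hV]; ring
    omega
  exact key _ _ _ _ _ _ rfl q1 q2 q3 q5 q6

end Program

end ValuedPCSP

/-! ### Reductions from Gap Label Cover -/

namespace ValuedPCSP

instance {S : Signature} (A B : ValuedStructure S) (N : Type) [Finite N] :
    Finite (PolFeas A B N) :=
  Finite.of_injective (β := ∀ t, Pow A.Dom N t → B.Dom t) (fun f => f.1) fun _ _ => Subtype.ext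

/-- The slope of the affine function `γ` can be made rational without losing the soundness
condition, which is a finite system of linear inequalities on the slope. -/
theorem exists_rat_slope_of_affine {S : Signature} {A B : ValuedStructure S} {s : ℚ}
    {D E : Type} [Fintype D] [Fintype E] {ε : ℝ}
    {LD : PolFeas A B D → FinDist D} {LE : PolFeas A B E → FinDist E}
    {Φ : PayoffFormula S (PairVars A.Dom D E)} {π : D → E} {γ : ℝ →ᵃ[ℝ] ℝ}
    (hγmono : Monotone γ) (hγs : ε ≤ γ (s : ℝ))
    (hsound : ∀ (fD : PolFeas A B D) (fE : PolFeas A B E),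
      WithBot.map (fun q : ℚ => γ (q : ℝ)) (eval Φ B (pairMap fD.1 fE.1)) ≤
        ((((LD fD).expect fun d => (LE fE).expect fun e => labelPayoff π d e : ℚ) : ℝ) :
          WithBot ℝ)) :
    ∃ α : ℚ≥0, ∀ (fD : PolFeas A B D) (fE : PolFeas A B E),
      IsFeasible Φ B (pairMap fD.1 fE.1) →
      (α : ℝ) * ((value Φ B (pairMap fD.1 fE.1) - s : ℚ) : ℝ) + ε ≤
        (((LD fD).expect fun d => (LE fE).expect fun e => labelPayoff π d e : ℚ) : ℝ) := by
  have hγ : ∀ x y : ℝ, γ x = γ.linear 1 * (x - y) + γ y := by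
    intro x y
    have h := γ.linearMap_vsub x y
    simp only [vsub_eq_sub] at h
    have h' : γ.linear (x - y) = (x - y) * γ.linear 1 := by
      rw [← smul_eq_mul, ← map_smul, smul_eq_mul, mul_one]
    rw [mul_comm, ← h', h, sub_add_cancel]
  obtain ⟨α, hα⟩ := exists_rat_slope
    (J := {f : PolFeas A B D × PolFeas A B E // IsFeasible Φ B (pairMap f.1.1 f.2.1)})
    (fun f => value Φ B (pairMap f.1.1.1 f.1.2.1) - s)
    (fun f => (LD f.1.1).expect fun d => (LE f.1.2).expect fun e => labelPayoff π d e)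
    (γ.linear 1) ε (by
      have h := hγ 1 0
      have := hγmono (zero_le_one (α := ℝ))
      linarith) (by
      rintro ⟨⟨fD, fE⟩, hf⟩
      have h := hsound fD fE
      rw [eval_of_isFeasible hf, WithBot.map_coe, WithBot.coe_le_coe, hγ _ s] at h
      push_cast at h ⊢
      linarith)
  exact ⟨α, fun fD fE hf => hα ⟨(fD, fE), hf⟩⟩

/-- Finitely many formulas with rational weights, scaled by rational factors, have integral
weights after multiplication by a common denominator. -/
theorem exists_multiplicity {S : Signature} {X : S.Srt → Type} {ι : Type} [Finite ι]
    (Φ : ι → PayoffFormula S X) (α : ι → ℚ≥0) :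
    ∃ (R : ℕ) (mult : ι → Constraint S X → ℕ), 0 < R ∧
      ∀ i, ∀ C ∈ Φ i, (mult i C : ℚ≥0) = (R * α i) * C.weight := by
  classical
  obtain ⟨R, hR, h⟩ := exists_common_denominator
    ((enum ι).flatMap fun i => (Φ i).map fun C => α i * C.weight)
  have h' : ∀ i C, ∃ n : ℕ, C ∈ Φ i → (n : ℚ≥0) = (R * α i) * C.weight := by
    intro i C
    by_cases hC : C ∈ Φ i
    · obtain ⟨n, hn⟩ := h (α i * C.weight)
        (List.mem_flatMap.2 ⟨i, mem_enum i, List.mem_map_of_mem hC⟩)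
      exact ⟨n, fun _ => by rw [hn, mul_assoc]⟩
    · exact ⟨0, fun hC' => absurd hC' hC⟩
  choose mult hmult using h'
  exact ⟨R, mult, hR, hmult⟩

/-- The reduction is computable in polynomial time. -/
theorem nonempty_polyTime_reducedInstance {S : Signature} {A : ValuedStructure S} {D E : Type}
    [Finite D] [Finite E] (pat : (D → E) → List (Pattern S (PairVars A.Dom D E))) :
    Nonempty (Turing.TM2ComputableInPolyTime encodeInstance encodeInstance
      (reducedInstance pat)) := by
  obtain ⟨K, hK⟩ := exists_runsIn_reductionProg pat
  let _ : Fintype Store := Fintype.ofFinite Store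
  refine StackProgram.nonempty_polyTime (Γ := Alphabet S (glcSignature D E)) (reductionProg pat)
    .inp .out encodeInstance encodeInstance (reducedInstance pat)
    (Polynomial.C K * (Polynomial.X + 1) ^ 2) fun I => ?_
  have h : (Polynomial.C K * (Polynomial.X + 1) ^ 2 : Polynomial ℕ).eval
      (encodeInstance I).length = K * ((encodeInstance I).length + 1) ^ 2 := by simp
  exact (hK I).mono h.ge

end ValuedPCSP

theorem mainTheorem10 {S : Signature} (A B : ValuedStructure S) (c s : ℚ)
    (hT : IsTemplate A B (c : ℝ) (s : ℝ))
    (D E : Type) [Fintype D] [Fintype E] (ε : ℝ)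
    (LD : PolFeas A B D → FinDist D) (LE : PolFeas A B E → FinDist E)
    (Φ : (D → E) → PayoffFormula S (PairVars A.Dom D E))
    (hΦ : ∀ π, totalWeight (Φ π) = 1)
    (γ : (D → E) → ℝ →ᵃ[ℝ] ℝ)
    (hγmono : ∀ π, Monotone (γ π))
    (hγs : ∀ π, ε ≤ γ π (s : ℝ))
    (hcomplete : ∀ (π : D → E) (d : D),
      ((c : ℚ) : WithBot ℚ) ≤ eval (Φ π) A (pairMap (proj A.Dom d) (proj A.Dom (π d))))
    (hsound : ∀ (π : D → E) (fD : PolFeas A B D) (fE : PolFeas A B E),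
      WithBot.map (fun q : ℚ => γ π (q : ℝ)) (eval (Φ π) B (pairMap fD.1 fE.1)) ≤
        ((((LD fD).expect fun d => (LE fE).expect fun e => labelPayoff π d e : ℚ) : ℝ) :
          WithBot ℝ)) :
    PolyTimeReducible (GLC D E 1 ε) (PCSP A B (c : ℝ) (s : ℝ)) := by
  choose α hα using fun π =>
    exists_rat_slope_of_affine (hγmono π) (hγs π) (hsound π)
  obtain ⟨R, mult, hR, hr⟩ := exists_multiplicity Φ α
  refine ⟨reducedInstance fun π => copies (mult π) (Φ π), nonempty_polyTime_reducedInstance _,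
    fun I hI => ?_, fun I hI h => ?_⟩
  · exact exists_atLeast_reducedInstance_iff.2
      (exists_atLeast_blockFormula (r := fun π => R * α π) hΦ hr hcomplete hI)
  · by_contra hh
    obtain ⟨g, hg⟩ := exists_glc_atLeast hΦ hR hr LD LE hα
      (exists_atLeast_reducedInstance_iff.1 ⟨h, not_below_iff.1 hh⟩)
    exact not_below_iff.2 hg (hI g)
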